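/- Let $K$ be a field with $n$ commuting derivations $\partial_1,\dots,\partial_n$, let $D=K[d_1,\dots,d_n]$ be the ring of differential operators over $K$ (so $d_id_j=d_jd_i$ and $d_ia=ad_i+\partial_ia$ for $a\in K$), and consider a first-order linear system with no zero-order equations in $m$ unknowns, $$\Phi^\tau\equiv\sum_{k}\sum_{i} a^{\tau i}_k\,y^k_i+\sum_k b^\tau_k\,y^k=0,\qquad \tau=1,\dots,p,\quad a^{\tau i}_k,\,b^\tau_k\in K,$$ sorted by classes: each equation has a class $i\in\{1,\dots,n\}$, an equation of class $i$ contains no $y^k_j$ with $j>i$, and for each $i$ the equations of class $i$ have linearly independent coefficient rows $(a^{\tau i}_k)_k$, i.e. they can be solved with respect to as many jets $y^k_i$. Suppose that the system is involutive: for all $\tau,j$, the equation $d_j\Phi^\tau$ is a linear combination over $K$ of the $\Phi^\sigma$ and the $d_l\Phi^\sigma$ with $l\le$ the class of $\Phi^\sigma$. Let $M=D^m/\sum_\tau D\Phi^\tau$ and suppose that $cd(M)=r$, i.e. the Hilbert polynomial giving $\dim_K M_q$ for large $q$ is nonzero of degree $n-r$, where $M_q$ is the image in $M$ of the elements of $D^m$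 of order $\le q$. Put $D'=K[d_1,\dots,d_{n-r}]\subseteq D$, let $F$ be the skew field of left fractions of $D'$ (when $\partial_1=\dots=\partial_{n-r}=0$ it is the field $K(\chi_1,\dots,\chi_{n-r})$), and for a left $D'$-module $X$ let $F\otimes_{D'}X$ be its relative localization in $(d_1,\dots,d_{n-r})$. Equations of class $\le n-r$ only involve $d_1,\dots,d_{n-r}$, hence lie in $D'^m$; let $M_r=D'^m/\sum_{\mathrm{class}(\Phi^\tau)\le n-r}D'\Phi^\tau$, and let $W\subseteq F^m$ be the left $F$-subspace generated by the equations of strict class $n-r$. Then: 1. every equation of class $1,\dots,n-r-1$ lies in $W$ after localization, i.e. it becomes a linear combination over $F$ of the equations of strict class $n-r$; 2. in $F\otimes_{D'}D^m$, the localization of the submodule of $D^m$ generated by all the equations equals the localization of the submodule generated by the equations of class $\ge n-r$, so that the equations of class $1,\dots,n-r-1$ are redundant for the localization of $M$; 3. there is an isomorphism $F^m/W\simeq F\otimes_{D'}M_r$ of left $F$-vector spaces that maps the class of the $k$-th basis vector to $1\otimes\bar y^k$ for all $k$; 4. there is an isomorphism $F^m/W\simeq F\otimes_{D'}M$ of left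 $F$-vector spaces that maps the class of the $k$-th basis vector to $1\otimes\bar y^k$ for all $k$. In particular, the localized modules $F\otimes_{D'}M_r$ and $F\otimes_{D'}M$ are determined, as left $F$-vector spaces with the generators $1\otimes\bar y^1,\dots,1\otimes\bar y^m$, by the equations of strict class $n-r$ alone. -/

import Mathlib

/-- A structure of differential field on `K` with `n` commuting derivations
`∂₁, …, ∂ₙ`; the index `i : Fin n` stands for the variable `xⁱ⁺¹`. -/
structure CommDerivations (n : ℕ) (K : Type*) [Field K] where
  /-- the derivations -/
  der : Fin n → Derivation ℤ K K
  /-- they commute pairwise -/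
  comm : ∀ i j a, der i (der j a) = der j (der i a)

/-- The ring `D = K[d₁, …, dₙ]` of (linear, scalar) differential operators with coefficients in the
differential field `K`. As a left `K`-vector space it has the basis of the monomials `d_μ`, and the
operator `∑ a_μ d_μ` is coded by the family of its coefficients `a_μ`. -/
def DiffOp {n : ℕ} {K : Type*} [Field K] (_Δ : CommDerivations n K) : Type _ :=
  (Fin n →₀ ℕ) →₀ K

namespace DiffOp

noncomputable section

variable {n : ℕ} {K : Type*} [Field K] {Δ : CommDerivations n K}

instance : AddCommGroup (DiffOp Δ) := inferInstanceAs (AddCommGroup ((Fin n →₀ ℕ) →₀ K))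

instance : Module K (DiffOp Δ) := inferInstanceAs (Module K ((Fin n →₀ ℕ) →₀ K))

/-- The coefficient `a_μ` of `d_μ` in an operator. -/
def coeff (μ : Fin n →₀ ℕ) : DiffOp Δ →ₗ[K] K := Finsupp.lapply μ

/-- The operator `a d_μ`. -/
def mono (μ : Fin n →₀ ℕ) : K →ₗ[K] DiffOp Δ := Finsupp.lsingle μ

lemma ext_coeff {P Q : DiffOp Δ} (h : ∀ μ, coeff μ P = coeff μ Q) : P = Q := Finsupp.ext h

lemma addHom_ext_mono {A : Type*} [AddZeroClass A] {f g : DiffOp Δ →+ A}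
    (h : ∀ μ a, f (mono μ a) = g (mono μ a)) : f = g := Finsupp.addHom_ext h

lemma coeff_mono (μ ν : Fin n →₀ ℕ) (a : K) :
    coeff ν (mono (Δ := Δ) μ a) = if μ = ν then a else 0 := by
  classical
  exact Finsupp.single_apply

/-- Left multiplication by `dᵢ`, determined by `dᵢ (a d_μ) = a d_{μ + 1ᵢ} + (∂ᵢ a) d_μ`. -/
def lmulD (Δ : CommDerivations n K) (i : Fin n) : AddMonoid.End (DiffOp Δ) :=
  Finsupp.liftAddHom (M := K) (N := DiffOp Δ) fun μ =>
    (mono (μ + Finsupp.single i 1)).toAddMonoidHom +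
      ((mono μ).toAddMonoidHom.comp (Δ.der i : K →+ K))

lemma lmulD_mono (i : Fin n) (μ : Fin n →₀ ℕ) (a : K) :
    lmulD Δ i (mono μ a) = mono (μ + Finsupp.single i 1) a + mono μ (Δ.der i a) := by
  refine (Finsupp.liftAddHom_apply_single _ _ _).trans ?_
  rfl

lemma lmulD_comm (i j : Fin n) : Commute (lmulD Δ i) (lmulD Δ j) := by
  refine addHom_ext_mono fun μ a => ?_
  change lmulD Δ i (lmulD Δ j _) = lmulD Δ j (lmulD Δ i _)
  simp only [lmulD_mono, map_add, Δ.comm i j a]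
  rw [add_right_comm μ]
  abel

lemma lmulD_pairwise (Δ : CommDerivations n K) (s : Finset (Fin n)) (μ : Fin n → ℕ) :
    (s : Set (Fin n)).Pairwise (Function.onFun Commute fun i => lmulD Δ i ^ μ i) :=
  fun i _ j _ _ => (lmulD_comm i j).pow_pow _ _

/-- Left multiplication by the monomial `d_μ`: the composite of the left multiplications by the
`dᵢ`, each one taken `μᵢ` times. -/
def lmulMon (Δ : CommDerivations n K) (μ : Fin n →₀ ℕ) : AddMonoid.End (DiffOp Δ) :=
  Finset.univ.noncommProd (fun i => lmulD Δ i ^ μ i) (lmulD_pairwise Δ _ _)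

lemma lmulMon_add (μ ν : Fin n →₀ ℕ) : lmulMon Δ (μ + ν) = lmulMon Δ μ * lmulMon Δ ν := by
  refine Eq.trans ?_ (Finset.noncommProd_mul_distrib (s := Finset.univ)
    (fun i => lmulD Δ i ^ μ i) (fun i => lmulD Δ i ^ ν i) (lmulD_pairwise Δ _ _)
    (lmulD_pairwise Δ _ _) fun i _ j _ _ => (lmulD_comm i j).pow_pow _ _)
  refine Finset.noncommProd_congr rfl ?_ _
  intro i _
  exact pow_add _ _ _

lemma lmulMon_zero : lmulMon Δ 0 = 1 := by
  unfold lmulMon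
  rw [Finset.noncommProd_eq_pow_card _ _ _ 1 (fun i _ => by simp), one_pow]

lemma lmulMon_single (i : Fin n) : lmulMon Δ (Finsupp.single i 1) = lmulD Δ i := by
  classical
  have h := Finset.noncommProd_insert_of_notMem (Finset.univ.erase i) i
    (fun j => lmulD Δ j ^ (Finsupp.single i 1 : Fin n →₀ ℕ) j) (lmulD_pairwise Δ _ _) (by simp)
  refine (Finset.noncommProd_congr (Finset.insert_erase (Finset.mem_univ i)).symm
    (fun _ _ => rfl) _).trans (h.trans ?_)
  rw [Finset.noncommProd_eq_pow_card _ _ _ 1]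
  · simp
  · intro j hj
    have : i ≠ j := fun h => by simp [h] at hj
    simp [this]

lemma endo_mul_apply (f g : AddMonoid.End (DiffOp Δ)) (P : DiffOp Δ) : (f * g) P = f (g P) := rfl

lemma endo_add_apply (f g : AddMonoid.End (DiffOp Δ)) (P : DiffOp Δ) : (f + g) P = f P + g P := rfl

/-- Multiplication of operators: `(∑ a_μ d_μ) Q = ∑ a_μ (d_μ Q)`. -/
def mulHom (Δ : CommDerivations n K) : DiffOp Δ →+ AddMonoid.End (DiffOp Δ) :=
  Finsupp.liftAddHom (M := K) (N := AddMonoid.End (DiffOp Δ)) fun μ =>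
    { toFun := fun a => (DistribSMul.toAddMonoidHom (DiffOp Δ) a).comp (lmulMon Δ μ)
      map_zero' := AddMonoidHom.ext fun x => zero_smul K (lmulMon Δ μ x)
      map_add' := fun a b => AddMonoidHom.ext fun x => add_smul a b (lmulMon Δ μ x) }

lemma mulHom_mono (μ : Fin n →₀ ℕ) (a : K) (Q : DiffOp Δ) :
    mulHom Δ (mono μ a) Q = a • lmulMon Δ μ Q :=
  DFunLike.congr_fun (Finsupp.liftAddHom_apply_single (M := K)
    (N := AddMonoid.End (DiffOp Δ)) _ μ a) Q

lemma mulHom_smul (a : K) (P Q : DiffOp Δ) : mulHom Δ (a • P) Q = a • mulHom Δ P Q := by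
  suffices h : ((mulHom Δ).comp (DistribSMul.toAddMonoidHom (DiffOp Δ) a)) =
      (AddMonoidHom.comp (AddMonoidHom.mulLeft (R := AddMonoid.End (DiffOp Δ))
        (DistribSMul.toAddMonoidHom (DiffOp Δ) a)) (mulHom Δ)) from
    DFunLike.congr_fun (DFunLike.congr_fun h P) Q
  refine addHom_ext_mono fun μ b => ?_
  ext1 Q
  change mulHom Δ (a • mono μ b) Q = a • mulHom Δ (mono μ b) Q
  rw [← map_smul, mulHom_mono, mulHom_mono, smul_eq_mul, mul_smul]

lemma lmulD_smul (i : Fin n) (a : K) (P : DiffOp Δ) :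
    lmulD Δ i (a • P) = a • lmulD Δ i P + Δ.der i a • P := by
  suffices h : ((lmulD Δ i).comp (DistribSMul.toAddMonoidHom (DiffOp Δ) a)) =
      (DistribSMul.toAddMonoidHom (DiffOp Δ) a).comp (lmulD Δ i) +
        DistribSMul.toAddMonoidHom (DiffOp Δ) (Δ.der i a) from DFunLike.congr_fun h P
  refine addHom_ext_mono fun μ b => ?_
  change lmulD Δ i (a • mono μ b) = a • lmulD Δ i (mono μ b) + Δ.der i a • mono μ b
  rw [← map_smul, lmulD_mono, lmulD_mono, smul_add, smul_eq_mul, Derivation.leibniz, map_add,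
    ← map_smul (mono _), ← map_smul (mono _), ← map_smul (mono _), add_assoc]
  simp only [smul_eq_mul, mul_comm b]

lemma mulHom_lmulD (i : Fin n) (P : DiffOp Δ) :
    mulHom Δ (lmulD Δ i P) = lmulD Δ i * mulHom Δ P := by
  suffices h : (mulHom Δ).comp (lmulD Δ i) =
      (AddMonoidHom.mulLeft (R := AddMonoid.End (DiffOp Δ)) (lmulD Δ i)).comp (mulHom Δ) from
    DFunLike.congr_fun h P
  refine addHom_ext_mono fun μ b => ?_
  ext1 Q
  change mulHom Δ (lmulD Δ i (mono μ b)) Q = lmulD Δ i (mulHom Δ (mono μ b) Q)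
  rw [lmulD_mono, map_add, endo_add_apply, mulHom_mono, mulHom_mono, mulHom_mono, lmulD_smul,
    add_comm μ, lmulMon_add, lmulMon_single]
  rfl

lemma mulHom_lmulMon (μ : Fin n →₀ ℕ) (P : DiffOp Δ) :
    mulHom Δ (lmulMon Δ μ P) = lmulMon Δ μ * mulHom Δ P := by
  induction μ using Finsupp.induction_linear generalizing P with
  | zero => simp [lmulMon_zero]
  | add μ ν hμ hν =>
    rw [lmulMon_add, endo_mul_apply, hμ, hν, mul_assoc]
  | single i k =>
    induction k generalizing P with
    | zero => simp [lmulMon_zero]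
    | succ k ih =>
      rw [Finsupp.single_add, lmulMon_add, endo_mul_apply, ih, lmulMon_single,
        mulHom_lmulD, mul_assoc]

lemma mulHom_mulHom (P Q : DiffOp Δ) : mulHom Δ (mulHom Δ P Q) = mulHom Δ P * mulHom Δ Q := by
  suffices h : (mulHom Δ).comp ((mulHom Δ).flip Q) =
      (AddMonoidHom.mulRight (R := AddMonoid.End (DiffOp Δ)) (mulHom Δ Q)).comp (mulHom Δ) from
    DFunLike.congr_fun h P
  refine addHom_ext_mono fun μ b => ?_
  ext1 R
  change mulHom Δ (mulHom Δ (mono μ b) Q) R = mulHom Δ (mono μ b) (mulHom Δ Q R)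
  rw [mulHom_mono, mulHom_mono, mulHom_smul, mulHom_lmulMon]
  rfl

lemma lmulMon_mono_one (μ ν : Fin n →₀ ℕ) :
    lmulMon Δ μ (mono ν 1) = mono (μ + ν) 1 := by
  induction μ using Finsupp.induction_linear generalizing ν with
  | zero => simp [lmulMon_zero]
  | add μ μ' hμ hν =>
    rw [lmulMon_add, endo_mul_apply, hν, hμ, add_assoc]
  | single i k =>
    induction k generalizing ν with
    | zero => simp [lmulMon_zero]
    | succ k ih =>
      rw [Finsupp.single_add, lmulMon_add, endo_mul_apply, lmulMon_single, lmulD_mono,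
        map_add, ih]
      rw [Derivation.map_one_eq_zero, map_zero, map_zero, add_zero, add_assoc,
        add_comm ν]

instance : Mul (DiffOp Δ) := ⟨fun P Q => mulHom Δ P Q⟩

instance : One (DiffOp Δ) := ⟨mono 0 1⟩

lemma mul_def (P Q : DiffOp Δ) : P * Q = mulHom Δ P Q := rfl

lemma one_def : (1 : DiffOp Δ) = mono 0 1 := rfl

instance : Ring (DiffOp Δ) :=
  { (inferInstance : AddCommGroup (DiffOp Δ)), (inferInstance : Mul (DiffOp Δ)),
    (inferInstance : One (DiffOp Δ)) with
    left_distrib := fun P Q R => map_add (mulHom Δ P) Q R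
    right_distrib := fun P Q R => by simp only [mul_def, map_add, endo_add_apply]
    zero_mul := fun P => by simp [mul_def]
    mul_zero := fun P => map_zero (mulHom Δ P)
    mul_assoc := fun P Q R => by
      simp only [mul_def, mulHom_mulHom]; rfl
    one_mul := fun P => by simp [mul_def, one_def, mulHom_mono, lmulMon_zero]
    mul_one := fun P => by
      suffices h : (mulHom Δ).flip (mono 0 1) = AddMonoidHom.id _ from DFunLike.congr_fun h P
      refine addHom_ext_mono fun μ b => ?_
      change mulHom Δ (mono μ b) (mono 0 1) = mono μ b
      rw [mulHom_mono, lmulMon_mono_one, ← map_smul]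
      simp }

/-- The element `a` of `K` as an operator of order zero. -/
def C (Δ : CommDerivations n K) (a : K) : DiffOp Δ := mono 0 a

/-- The operator `dᵢ`. -/
def d (Δ : CommDerivations n K) (i : Fin n) : DiffOp Δ := mono (Finsupp.single i 1) 1

instance : IsScalarTower K (DiffOp Δ) (DiffOp Δ) := ⟨fun a P Q => mulHom_smul a P Q⟩

lemma C_mul (a : K) (P : DiffOp Δ) : C Δ a * P = a • P := by
  simp [C, mul_def, mulHom_mono, lmulMon_zero]

/-- The commutation relations `dᵢ a = a dᵢ + ∂ᵢ a`. -/
lemma d_mul_C (i : Fin n) (a : K) : d Δ i * C Δ a = C Δ a * d Δ i + C Δ (Δ.der i a) := by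
  rw [C_mul, d, C, C, mul_def, mulHom_mono, lmulMon_single, lmulD_mono, ← map_smul]
  simp

lemma d_mul_d (i j : Fin n) : d Δ i * d Δ j = d Δ j * d Δ i := by
  simp only [d, mul_def, mulHom_mono, lmulMon_mono_one, add_comm]

/-! ### Supports of products -/

lemma coeff_lmulD (i : Fin n) (P : DiffOp Δ) (κ : Fin n →₀ ℕ) :
    coeff κ (lmulD Δ i P) =
      (if Finsupp.single i 1 ≤ κ then coeff (κ - Finsupp.single i 1) P else 0) +
        Δ.der i (coeff κ P) := by
  classical
  suffices h : (coeff κ).toAddMonoidHom.comp (lmulD Δ i) =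
      (if Finsupp.single i 1 ≤ κ then (coeff (κ - Finsupp.single i 1)).toAddMonoidHom else 0) +
        (Δ.der i : K →+ K).comp (coeff κ).toAddMonoidHom by
    have := DFunLike.congr_fun h P
    split_ifs at this ⊢ <;> exact this
  refine addHom_ext_mono fun μ b => ?_
  have key : coeff κ (lmulD Δ i (mono μ b)) =
      (if Finsupp.single i 1 ≤ κ then coeff (κ - Finsupp.single i 1) (mono (Δ := Δ) μ b) else 0) +
        Δ.der i (coeff κ (mono (Δ := Δ) μ b)) := by
    rw [lmulD_mono, map_add]
    simp only [coeff_mono]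
    congr 1
    · by_cases h : Finsupp.single i 1 ≤ κ
      · rw [if_pos h]
        exact if_congr (eq_tsub_iff_add_eq_of_le h).symm rfl rfl
      · rw [if_neg h, if_neg]
        rintro rfl
        exact h le_add_self
    · split_ifs <;> simp
  split_ifs at key ⊢ <;> exact key

lemma coeff_lmulMon (μ ν : Fin n →₀ ℕ) (b : K) :
    (∀ κ, ¬ κ ≤ μ + ν → coeff κ (lmulMon Δ μ (mono ν b)) = 0) ∧
      coeff (μ + ν) (lmulMon Δ μ (mono ν b)) = b := by
  classical
  have step : ∀ (i : Fin n) (ρ : Fin n →₀ ℕ) (P : DiffOp Δ),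
      ((∀ κ, ¬ κ ≤ ρ → coeff κ P = 0) ∧ coeff ρ P = b) →
      ((∀ κ, ¬ κ ≤ Finsupp.single i 1 + ρ → coeff κ (lmulD Δ i P) = 0) ∧
        coeff (Finsupp.single i 1 + ρ) (lmulD Δ i P) = b) := by
    rintro i ρ P ⟨h0, h1⟩
    constructor
    · intro κ hκ
      rw [coeff_lmulD, h0 κ fun h => hκ (h.trans le_add_self), map_zero, add_zero]
      split_ifs with h
      · refine h0 _ fun h' => hκ ?_
        exact tsub_le_iff_left.mp h'
      · rfl
    · rw [coeff_lmulD, if_pos le_self_add, add_tsub_cancel_left, h1, h0, map_zero, add_zero]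
      intro h
      have := h i
      simp at this
  have single_case : ∀ (i : Fin n) (k : ℕ) (ρ : Fin n →₀ ℕ) (P : DiffOp Δ),
      ((∀ κ, ¬ κ ≤ ρ → coeff κ P = 0) ∧ coeff ρ P = b) →
      ((∀ κ, ¬ κ ≤ Finsupp.single i k + ρ → coeff κ (lmulMon Δ (Finsupp.single i k) P) = 0) ∧
        coeff (Finsupp.single i k + ρ) (lmulMon Δ (Finsupp.single i k) P) = b) := by
    intro i k
    induction k with
    | zero => intro ρ P h; simpa [lmulMon_zero] using h
    | succ k ih =>
      intro ρ P h
      rw [Finsupp.single_add, lmulMon_add, endo_mul_apply, lmulMon_single, add_assoc]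
      exact ih _ _ (step i ρ P h)
  have gen : ∀ (ρ : Fin n →₀ ℕ) (P : DiffOp Δ),
      ((∀ κ, ¬ κ ≤ ρ → coeff κ P = 0) ∧ coeff ρ P = b) →
      ((∀ κ, ¬ κ ≤ μ + ρ → coeff κ (lmulMon Δ μ P) = 0) ∧
        coeff (μ + ρ) (lmulMon Δ μ P) = b) := by
    induction μ using Finsupp.induction_linear with
    | zero => intro ρ P h; simpa [lmulMon_zero] using h
    | add μ μ' h1 h2 =>
      intro ρ P h
      rw [lmulMon_add, endo_mul_apply, add_assoc]
      exact h1 _ _ (h2 _ _ h)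
    | single i k => exact single_case i k
  refine gen ν (mono ν b) ⟨fun κ hκ => ?_, by simp [coeff_mono]⟩
  rw [coeff_mono, if_neg]
  rintro rfl
  exact hκ le_rfl

lemma sum_mono (P : DiffOp Δ) : ∑ μ ∈ Finsupp.support P, mono μ (coeff μ P) = P :=
  Finsupp.sum_single P

lemma coeff_mul (P Q : DiffOp Δ) (κ : Fin n →₀ ℕ) :
    coeff κ (P * Q) = ∑ μ ∈ Finsupp.support P, ∑ ν ∈ Finsupp.support Q,
      coeff μ P * coeff κ (lmulMon Δ μ (mono ν (coeff ν Q))) := by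
  conv_lhs => rw [← sum_mono P, ← sum_mono Q]
  simp only [Finset.sum_mul, map_sum, Finset.mul_sum, mul_def, mulHom_mono, map_smul, smul_eq_mul]
  exact Finset.sum_comm

lemma exists_of_coeff_mul_ne_zero {P Q : DiffOp Δ} {κ : Fin n →₀ ℕ} (h : coeff κ (P * Q) ≠ 0) :
    ∃ μ ν, coeff μ P ≠ 0 ∧ coeff ν Q ≠ 0 ∧ κ ≤ μ + ν := by
  rw [coeff_mul] at h
  obtain ⟨μ, hμ, h⟩ := Finset.exists_ne_zero_of_sum_ne_zero h
  obtain ⟨ν, hν, h⟩ := Finset.exists_ne_zero_of_sum_ne_zero h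
  refine ⟨μ, ν, Finsupp.mem_support_iff.mp hμ, Finsupp.mem_support_iff.mp hν, ?_⟩
  by_contra hle
  exact h (by rw [(coeff_lmulMon μ ν _).1 κ hle, mul_zero])

instance : Nontrivial (DiffOp Δ) := inferInstanceAs (Nontrivial ((Fin n →₀ ℕ) →₀ K))

instance : NoZeroDivisors (DiffOp Δ) where
  eq_zero_or_eq_zero_of_mul_eq_zero {P Q} h := by
    by_contra! hPQ
    obtain ⟨hP, hQ⟩ := hPQ
    obtain ⟨μ, hμ, hμ'⟩ := Finset.exists_max_image (Finsupp.support P) toLex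
      (Finsupp.support_nonempty_iff.mpr hP)
    obtain ⟨ν, hν, hν'⟩ := Finset.exists_max_image (Finsupp.support Q) toLex
      (Finsupp.support_nonempty_iff.mpr hQ)
    have hc : coeff (μ + ν) (P * Q) = coeff μ P * coeff ν Q := by
      have zero : ∀ μ' ∈ Finsupp.support P, ∀ ν' ∈ Finsupp.support Q, (μ' ≠ μ ∨ ν' ≠ ν) →
          coeff μ' P * coeff (μ + ν) (lmulMon Δ μ' (mono ν' (coeff ν' Q))) = 0 := by
        intro μ' h1 ν' h2 hne
        rw [(coeff_lmulMon μ' ν' _).1 (μ + ν), mul_zero]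
        intro hle
        have hle' : toLex μ + toLex ν ≤ toLex μ' + toLex ν' := Finsupp.toLex_monotone hle
        have a1 := hμ' μ' h1
        have a2 := hν' ν' h2
        rcases hne with hne | hne
        · exact absurd hle' (not_le.mpr (add_lt_add_of_lt_of_le
            (lt_of_le_of_ne a1 fun e => hne (toLex.injective e)) a2))
        · exact absurd hle' (not_le.mpr (add_lt_add_of_le_of_lt a1
            (lt_of_le_of_ne a2 fun e => hne (toLex.injective e))))
      rw [coeff_mul, Finset.sum_eq_single_of_mem μ hμ, Finset.sum_eq_single_of_mem ν hν,
        (coeff_lmulMon μ ν _).2]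
      · intro ν' h2 hne
        exact zero μ hμ ν' h2 (Or.inr hne)
      · intro μ' h1 hne
        exact Finset.sum_eq_zero fun ν' h2 => zero μ' h1 ν' h2 (Or.inl hne)
    rw [h, map_zero] at hc
    rcases mul_eq_zero.mp hc.symm with h | h
    · exact Finsupp.mem_support_iff.mp hμ h
    · exact Finsupp.mem_support_iff.mp hν h

/-- The subring `K[d₁, …, dₛ]` of `D` of the operators that involve only the first `s`
derivations. -/
def firstVars (Δ : CommDerivations n K) (s : ℕ) : Subring (DiffOp Δ) where
  carrier := {P | ∀ μ, coeff μ P ≠ 0 → ∀ j : Fin n, s ≤ j.val → μ j = 0}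
  zero_mem' := fun μ h => absurd (map_zero _) h
  one_mem' := fun μ h j _ => by
    rw [one_def, coeff_mono] at h
    have : 0 = μ := by by_contra h'; exact h (if_neg h')
    simp [← this]
  add_mem' := fun {P Q} hP hQ μ h j hj => by
    by_cases h' : coeff μ P = 0
    · exact hQ μ (fun h'' => h (by rw [map_add, h', h'', add_zero])) j hj
    · exact hP μ h' j hj
  neg_mem' := fun {P} hP μ h j hj => hP μ (fun h' => h (by rw [map_neg, h', neg_zero])) j hj
  mul_mem' := fun {P Q} hP hQ κ h j hj => by
    obtain ⟨μ, ν, h1, h2, hle⟩ := exists_of_coeff_mul_ne_zero h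
    have := hle j
    rw [Finsupp.add_apply, hP μ h1 j hj, hQ ν h2 j hj] at this
    omega

/-! ### The Ore property of `K[d₁, …, dₛ]` -/

/-- The operators all of whose multi-indices are bounded by `κ`. -/
def box (Δ : CommDerivations n K) (κ : Fin n →₀ ℕ) : Submodule K (DiffOp Δ) :=
  Finsupp.supported K K (Set.Iic κ)

lemma mem_box {κ : Fin n →₀ ℕ} {P : DiffOp Δ} : P ∈ box Δ κ ↔ ∀ μ, coeff μ P ≠ 0 → μ ≤ κ := by
  refine (Finsupp.mem_supported K P).trans ?_
  constructor
  · intro h μ hμ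
    exact h (Finsupp.mem_support_iff.mpr hμ)
  · intro h μ hμ
    exact h μ (Finsupp.mem_support_iff.mp hμ)

lemma mul_mem_box {κ κ' : Fin n →₀ ℕ} {P Q : DiffOp Δ} (hP : P ∈ box Δ κ) (hQ : Q ∈ box Δ κ') :
    P * Q ∈ box Δ (κ + κ') := by
  rw [mem_box] at *
  intro μ hμ
  obtain ⟨μ', ν', h1, h2, hle⟩ := exists_of_coeff_mul_ne_zero hμ
  exact hle.trans (add_le_add (hP _ h1) (hQ _ h2))

/-- The operators with bounded multi-indices form the coordinate space on these indices. -/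
def boxEquiv (Δ : CommDerivations n K) (κ : Fin n →₀ ℕ) : box Δ κ ≃ₗ[K] (Set.Iic κ →₀ K) :=
  Finsupp.supportedEquivFinsupp (R := K) (M := K) (Set.Iic κ)

instance (κ : Fin n →₀ ℕ) : FiniteDimensional K (box Δ κ) :=
  Module.Finite.equiv (boxEquiv Δ κ).symm

lemma finrank_box (κ : Fin n →₀ ℕ) : Module.finrank K (box Δ κ) = ∏ j, (κ j + 1) := by
  rw [(boxEquiv Δ κ).finrank_eq, Module.finrank_finsupp_self, ← Nat.card_eq_fintype_card]
  have : (Set.Iic κ) = ((Finset.Iic κ : Finset (Fin n →₀ ℕ)) : Set (Fin n →₀ ℕ)) := by ext; simp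
  rw [this, Nat.card_coe_set_eq, Set.ncard_coe_finset, Finsupp.card_Iic]
  simp only [Nat.card_Iic]
  refine Finset.prod_subset (Finset.subset_univ _) fun j _ hj => ?_
  rw [Finsupp.notMem_support_iff.mp hj, zero_add]

lemma exists_box_growth (κ : Fin n →₀ ℕ) :
    ∃ N : ℕ, ∏ j, (((N + 1) • κ) j + 1) < 2 * ∏ j, ((N • κ) j + 1) := by
  by_contra! hcon
  have h1 : ∀ N : ℕ, 2 ^ N ≤ ∏ j, ((N • κ) j + 1) := by
    intro N
    induction N with
    | zero => simp
    | succ N ih =>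
      calc 2 ^ (N + 1) = 2 * 2 ^ N := by ring
        _ ≤ _ := (Nat.mul_le_mul_left 2 ih).trans (hcon N)
  obtain ⟨B, hB⟩ : ∃ B : ℕ, ∀ j, κ j ≤ B :=
    ⟨∑ j, κ j, fun j => Finset.single_le_sum (fun _ _ => Nat.zero_le _) (Finset.mem_univ j)⟩
  have h2 : ∀ N : ℕ, 1 ≤ N → 2 ^ N ≤ (B + 1) ^ n * N ^ n := by
    intro N hN
    refine (h1 N).trans ?_
    calc ∏ j, ((N • κ) j + 1) ≤ ∏ _j : Fin n, ((B + 1) * N) := by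
          refine Finset.prod_le_prod' fun j _ => ?_
          have := hB j
          simp only [Finsupp.smul_apply, smul_eq_mul]
          nlinarith
      _ = (B + 1) ^ n * N ^ n := by simp [mul_pow]
  have ht := (tendsto_pow_const_div_const_pow_of_one_lt n (r := (2 : ℝ)) (by norm_num)).eventually
    (gt_mem_nhds (show (0 : ℝ) < 1 / ((B : ℝ) + 1) ^ n by positivity))
  obtain ⟨N, hN, hN1⟩ := (ht.and (Filter.eventually_ge_atTop 1)).exists
  have h3 := h2 N hN1
  have h4 : (2 : ℝ) ^ N ≤ ((B : ℝ) + 1) ^ n * (N : ℝ) ^ n := by exact_mod_cast h3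
  rw [div_lt_div_iff₀ (by positivity) (by positivity)] at hN
  linarith

lemma ore_condition (s : ℕ) (P : firstVars Δ s) (Q : nonZeroDivisors (firstVars Δ s)) :
    ∃ (P' : firstVars Δ s) (Q' : nonZeroDivisors (firstVars Δ s)), Q' * P = P' * Q := by
  classical
  obtain ⟨P, hP⟩ := P
  obtain ⟨⟨Q, hQ⟩, hQ0⟩ := Q
  have hQ0' : Q ≠ 0 := fun h => nonZeroDivisors.ne_zero hQ0 (Subtype.ext h)
  set κ : Fin n →₀ ℕ := (Finsupp.support P ∪ Finsupp.support Q).sup id with hκ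
  have hκ0 : ∀ j : Fin n, s ≤ j.val → κ j = 0 := by
    intro j hj
    let b : Fin n →₀ ℕ := κ.filter fun i => i.val < s
    have hb : κ ≤ b := by
      refine Finset.sup_le fun μ hμ i => ?_
      by_cases hi : i.val < s
      · simp only [b, Finsupp.filter_apply, hi, if_true]
        exact (Finset.le_sup (f := id) hμ : id μ ≤ κ) i
      · have : μ i = 0 := by
          rcases Finset.mem_union.mp hμ with h | h
          · exact hP μ (Finsupp.mem_support_iff.mp h) i (not_lt.mp hi)
          · exact hQ μ (Finsupp.mem_support_iff.mp h) i (not_lt.mp hi)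
        simp [this]
    have := hb j
    simpa [b, Finsupp.filter_apply, not_lt.mpr hj] using this
  have hPb : P ∈ box Δ κ := mem_box.mpr fun μ hμ =>
    Finset.le_sup (f := id) (Finset.mem_union_left _ (Finsupp.mem_support_iff.mpr hμ))
  have hQb : Q ∈ box Δ κ := mem_box.mpr fun μ hμ =>
    Finset.le_sup (f := id) (Finset.mem_union_right _ (Finsupp.mem_support_iff.mpr hμ))
  obtain ⟨N, hN⟩ := exists_box_growth κ
  have hsucc : (N + 1) • κ = N • κ + κ := succ_nsmul κ N
  let f : (box Δ (N • κ) × box Δ (N • κ)) →ₗ[K] box Δ ((N + 1) • κ) :=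
    { toFun := fun x => ⟨x.1.1 * P - x.2.1 * Q, by
        rw [hsucc]
        exact Submodule.sub_mem _ (mul_mem_box x.1.2 hPb) (mul_mem_box x.2.2 hQb)⟩
      map_add' := fun x y => Subtype.ext (by
        simp only [Prod.fst_add, Prod.snd_add, Submodule.coe_add, add_mul]
        abel)
      map_smul' := fun a x => Subtype.ext (by
        simp [smul_mul_assoc, smul_sub]) }
  have hlt : Module.finrank K (box Δ ((N + 1) • κ)) <
      Module.finrank K (box Δ (N • κ) × box Δ (N • κ)) := by
    rw [Module.finrank_prod, finrank_box, finrank_box]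
    omega
  obtain ⟨⟨⟨x, hx⟩, ⟨y, hy⟩⟩, hmem, hne⟩ :=
    (Submodule.ne_bot_iff _).mp (LinearMap.ker_ne_bot_of_finrank_lt (f := f) hlt)
  have heq : x * P = y * Q := sub_eq_zero.mp (congrArg Subtype.val (LinearMap.mem_ker.mp hmem))
  have hfirst : ∀ z ∈ box Δ (N • κ), z ∈ firstVars Δ s := by
    intro z hz μ hμ j hj
    have := mem_box.mp hz μ hμ j
    rw [Finsupp.smul_apply, hκ0 j hj] at this
    simpa using this
  have hx0 : x ≠ 0 := by
    rintro rfl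
    rw [zero_mul] at heq
    have hy0 : y = 0 := (mul_eq_zero.mp heq.symm).resolve_right hQ0'
    subst hy0
    exact hne rfl
  refine ⟨⟨y, hfirst y hy⟩, ⟨⟨x, hfirst x hx⟩, ?_⟩, Subtype.ext heq⟩
  exact mem_nonZeroDivisors_of_ne_zero fun h => hx0 (congrArg Subtype.val h)

/-- The nonzero elements of `K[d₁, …, dₛ]` form a left Ore set. -/
instance (s : ℕ) : OreLocalization.OreSet (nonZeroDivisors (firstVars Δ s)) :=
  (OreLocalization.nonempty_oreSet_iff_of_noZeroDivisors.mpr (ore_condition s)).some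

/-- The skew field of left fractions of `K[d₁, …, dₛ]`. When `∂₁, …, ∂ₛ` vanish on `K` it is
the field `K(χ₁, …, χₛ)` of rational functions. -/
abbrev FracFirst (Δ : CommDerivations n K) (s : ℕ) : Type _ :=
  OreLocalization (nonZeroDivisors (firstVars Δ s)) (firstVars Δ s)

/-- The relative localization in `(d₁, …, dₛ)` of a left module `X`: the left fractions
with numerators in `X` and denominators in `K[d₁, …, dₛ] ∖ {0}`. It is a left vector space over the
skew field `FracFirst Δ s`. -/
abbrev RelLoc (Δ : CommDerivations n K) (s : ℕ) (X : Type*) [AddCommGroup X]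
    [Module (firstVars Δ s) X] : Type _ :=
  OreLocalization (nonZeroDivisors (firstVars Δ s)) X

/-- The canonical map `x ↦ 1⁻¹ x` of a module to its relative localization. -/
def toLoc (Δ : CommDerivations n K) (s : ℕ) {X : Type*} [AddCommGroup X]
    [Module (firstVars Δ s) X] (x : X) : RelLoc Δ s X :=
  OreLocalization.oreDiv x 1

/-- The operators of order at most `q`. -/
def ofOrder (Δ : CommDerivations n K) (q : ℕ) : Submodule K (DiffOp Δ) :=
  Finsupp.supported K K {μ : Fin n →₀ ℕ | μ.degree ≤ q}

/-- The part `M_q` of the quotient filtration of `M = Dᵐ/I`: the residues of the elements of `Dᵐ` of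
order at most `q`. -/
def filtration {m : ℕ} (I : Submodule (DiffOp Δ) (Fin m → DiffOp Δ)) (q : ℕ) :
    Submodule K ((Fin m → DiffOp Δ) ⧸ I) :=
  (Submodule.pi Set.univ fun _ => ofOrder Δ q).map (I.mkQ.restrictScalars K)

/-- The differential module `M = Dᵐ/I` has codimension `cd(M) = r`: its Hilbert polynomial, which
gives the dimension over `K` of `M_q` for large `q`, is nonzero of degree `n - r`. -/
def HasCodim {m : ℕ} (I : Submodule (DiffOp Δ) (Fin m → DiffOp Δ)) (r : ℕ) : Prop :=
  ∃ h : Polynomial ℚ, h ≠ 0 ∧ h.natDegree + r = n ∧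
    ∀ᶠ q : ℕ in Filter.atTop, (Module.finrank K (filtration I q) : ℚ) = h.eval (q : ℚ)

end

end DiffOp

/-- A linear system of `p` first order equations
`Φ^τ ≡ ∑ₖ ∑ᵢ a^{τi}_k y^k_i + ∑ₖ b^τ_k y^k = 0` for `m` unknowns in `n` independent variables,
without zero order equations and sorted by classes: an equation of class `i` contains no jet `y^k_j`
with `j > i`, and the equations of class `i` can be solved with respect to as many jets
`y^k_i` of class `i`. -/
structure FirstOrderSystem (K : Type*) [Field K] (n m p : ℕ) where
  /-- the coefficient of the jet `y^k_i` -/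
  a : Fin p → Fin n → Fin m → K
  /-- the coefficient of `y^k` -/
  b : Fin p → Fin m → K
  /-- the class of an equation (`i : Fin n` codes the class `i + 1`) -/
  cls : Fin p → Fin n
  /-- only jets of class at most the class of the equation occur -/
  a_eq_zero : ∀ τ i, cls τ < i → ∀ k, a τ i k = 0
  /-- the equations of class `i` can be solved with respect to jets of class `i` -/
  solvable : ∀ i, LinearIndependent K fun (τ : {τ : Fin p // cls τ = i}) => a τ i

namespace FirstOrderSystem

noncomputable section

variable {n m p : ℕ} {K : Type*} [Field K]

/-- The class, in `{1, …, n}`, of the equation `Φ^τ`. -/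
def classNum (R : FirstOrderSystem K n m p) (τ : Fin p) : ℕ := (R.cls τ).val + 1

/-- The equation `Φ^τ` as an element of `Dᵐ = D y¹ + … + D yᵐ`. -/
def eqn (R : FirstOrderSystem K n m p) (Δ : CommDerivations n K) (τ : Fin p) :
    Fin m → DiffOp Δ :=
  fun k => ∑ i, R.a τ i k • DiffOp.d Δ i + DiffOp.C Δ (R.b τ k)

/-- The system is involutive: its first prolongation can be achieved by prolonging each equation
only with respect to its multiplicative variables `x¹, …, xⁱ`, with `i` the class of the
equation. -/
def IsInvolutive (R : FirstOrderSystem K n m p) (Δ : CommDerivations n K) : Prop :=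
  ∀ (τ : Fin p) (j : Fin n), DiffOp.d Δ j • R.eqn Δ τ ∈
    Submodule.span K (Set.range (R.eqn Δ) ∪
      {Ψ | ∃ (σ : Fin p) (l : Fin n), l ≤ R.cls σ ∧ Ψ = DiffOp.d Δ l • R.eqn Δ σ})

/-- The `D`-submodule of `Dᵐ` generated by the equations whose class satisfies `c`. -/
def equations (R : FirstOrderSystem K n m p) (Δ : CommDerivations n K) (c : ℕ → Prop) :
    Submodule (DiffOp Δ) (Fin m → DiffOp Δ) :=
  Submodule.span (DiffOp Δ) {Ψ | ∃ τ, c (R.classNum τ) ∧ Ψ = R.eqn Δ τ}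

/-- The differential module `M = Dᵐ/(DΦ¹ + … + DΦᵖ)` defined by the system. -/
abbrev diffModule (R : FirstOrderSystem K n m p) (Δ : CommDerivations n K) : Type _ :=
  (Fin m → DiffOp Δ) ⧸ R.equations Δ fun _ => True

lemma eqn_mem (R : FirstOrderSystem K n m p) (Δ : CommDerivations n K) {s : ℕ} {τ : Fin p}
    (h : R.classNum τ ≤ s) (k : Fin m) : R.eqn Δ τ k ∈ DiffOp.firstVars Δ s := by
  have hC : ∀ x, DiffOp.C Δ x ∈ DiffOp.firstVars Δ s := by
    intro x μ hμ j hj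
    rw [DiffOp.C, DiffOp.coeff_mono] at hμ
    have : 0 = μ := by by_contra h'; exact hμ (if_neg h')
    simp [← this]
  refine add_mem (sum_mem fun i _ => ?_) (hC _)
  by_cases hi : R.cls τ < i
  · rw [R.a_eq_zero τ i hi k, zero_smul]
    exact zero_mem _
  · rw [← DiffOp.C_mul]
    refine mul_mem (hC _) fun μ hμ j hj => ?_
    rw [DiffOp.d, DiffOp.coeff_mono] at hμ
    have h' : Finsupp.single i 1 = μ := by by_contra h'; exact hμ (if_neg h')
    have : i ≠ j := by
      rintro rfl
      have h1 : i.val ≤ (R.cls τ).val := not_lt.mp hi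
      unfold classNum at h
      omega
    rw [← h', Finsupp.single_apply, if_neg this]

/-- An equation of class at most `s` as an element of `K[d₁, …, dₛ]ᵐ`. -/
def eqnFirst (R : FirstOrderSystem K n m p) (Δ : CommDerivations n K) {s : ℕ} (τ : Fin p)
    (h : R.classNum τ ≤ s) : Fin m → DiffOp.firstVars Δ s :=
  fun k => ⟨R.eqn Δ τ k, R.eqn_mem Δ h k⟩

/-- The differential module over `K[d₁, …, dₛ]` defined by the equations of class `1` up to
class `s` only. With `s = n - r` it is the module `M_r`. -/
abbrev moduleUpTo (R : FirstOrderSystem K n m p) (Δ : CommDerivations n K) (s : ℕ) : Type _ :=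
  (Fin m → DiffOp.firstVars Δ s) ⧸ Submodule.span (DiffOp.firstVars Δ s)
    {Ψ : Fin m → DiffOp.firstVars Δ s | ∃ τ, ∃ h : R.classNum τ ≤ s, Ψ = R.eqnFirst Δ τ h}

/-- An equation of class at most `s` with `d₁, …, dₛ` replaced by their images in the skew
field of fractions. -/
def locEqn (R : FirstOrderSystem K n m p) (Δ : CommDerivations n K) {s : ℕ} (τ : Fin p)
    (h : R.classNum τ ≤ s) : Fin m → DiffOp.FracFirst Δ s :=
  fun k => OreLocalization.numeratorHom (R.eqnFirst Δ τ h k)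

/-- The subspace generated by the localized equations of strict class `s`. -/
def strictEquations (R : FirstOrderSystem K n m p) (Δ : CommDerivations n K) (s : ℕ) :
    Submodule (DiffOp.FracFirst Δ s) (Fin m → DiffOp.FracFirst Δ s) :=
  Submodule.span _ {Ψ | ∃ τ, ∃ h : R.classNum τ = s, Ψ = R.locEqn Δ τ h.le}

end

end FirstOrderSystem

/-! ### Leading terms in the colexicographic order -/

namespace DiffOp

noncomputable section

variable {n m : ℕ} {K : Type*} [Field K] {Δ : CommDerivations n K}

/-! Order the monomials colexicographically, with `d_n` most significant. The leading monomial of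
`d_μ Φ^τ` is `d_μ d_i`, with `i` the class of `Φ^τ`, and its vector coefficient is the row of class
`i` of `Φ^τ`. If `μ` is multiplicative (no `d_j` with `j > i`), then `i` is the last place of this
monomial, so it determines both `i` and `μ`. As the rows of one class are independent, leading terms
of multiplicative prolongations cannot cancel (`exists_lead_of_linearCombination`). Involutivity
makes these prolongations span all consequences of the system, without raising leading monomials
(`prolong_mem_span`).

Redundancy of the lower classes is a dimension count. Write `s = n - r` and let `Φ` have class at
most `s`. Modulo the equations of strict class `s`, each `d_s^k Φ` is a combination of the lower
equations with coefficients in `K[d₁, …, d_{s-1}]`, since these equations have no `d_s` among their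
multiplicative variables. There are at most `p` such equations, so the `p + 1` powers `k = 0, …, p`
yield a left relation over this Ore domain, that is, a nonzero `P = ∑ P_k d_s^k` with `P Φ` in the
span of strict class `s` (`exists_smul_mem`). After localization `P` is invertible.

The codimension compares `M` with `M_r`. If the rows of a class above `s` did not span `K^m`, the
jets missed by them would make the Hilbert polynomial grow too fast (`span_eq_top`). Hence every
element of `D^m` reduces modulo the system to `D'^m` (`exists_inclFirst_sub_mem`), while elimination
gives the kernel (`mem_span_eqnFirst`). Thus `M` and `M_r` have the same presentation over `D'`. -/

lemma mono_one_mul_mono_one (μ ν : Fin n →₀ ℕ) :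
    (mono μ 1 * mono ν 1 : DiffOp Δ) = mono (μ + ν) 1 := by
  rw [mul_def, mulHom_mono, lmulMon_mono_one, one_smul]

lemma d_eq_mono (i : Fin n) : d Δ i = mono (Finsupp.single i 1) 1 := rfl

lemma mono_eq_smul (μ : Fin n →₀ ℕ) (a : K) : (mono μ a : DiffOp Δ) = a • mono μ 1 := by
  rw [← map_smul, smul_eq_mul, mul_one]

lemma mono_mul_mono_one (μ ν : Fin n →₀ ℕ) (a : K) :
    (mono μ a * mono ν 1 : DiffOp Δ) = mono (μ + ν) a := by
  rw [mono_eq_smul, smul_mul_assoc, mono_one_mul_mono_one, ← mono_eq_smul]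

lemma coeff_d_mul (i : Fin n) (P : DiffOp Δ) (κ : Fin n →₀ ℕ) :
    coeff κ (d Δ i * P) =
      (if Finsupp.single i 1 ≤ κ then coeff (κ - Finsupp.single i 1) P else 0) +
        Δ.der i (coeff κ P) := by
  rw [← coeff_lmulD, d_eq_mono, mul_def, mulHom_mono, lmulMon_single, one_smul]

lemma coeff_mul_mono_one (ν κ : Fin n →₀ ℕ) (P : DiffOp Δ) :
    coeff κ (P * mono ν 1) = if ν ≤ κ then coeff (κ - ν) P else 0 := by
  conv_lhs => rw [← sum_mono P]
  conv_rhs => rw [← sum_mono P]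
  simp only [Finset.sum_mul, mono_mul_mono_one, map_sum]
  split_ifs with h
  · refine Finset.sum_congr rfl fun μ _ => ?_
    rw [coeff_mono, coeff_mono]
    exact if_congr (eq_tsub_iff_add_eq_of_le h).symm rfl rfl
  · refine Finset.sum_eq_zero fun μ _ => ?_
    rw [coeff_mono, if_neg]
    rintro rfl
    exact h le_add_self

/-- The vector of the coefficients of `d_κ` in the components of an element of `Dᵐ`. -/
def vcoeff (κ : Fin n →₀ ℕ) : (Fin m → DiffOp Δ) →ₗ[K] (Fin m → K) :=
  LinearMap.compLeft (coeff κ) (Fin m)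

lemma vcoeff_apply (κ : Fin n →₀ ℕ) (v : Fin m → DiffOp Δ) (k : Fin m) :
    vcoeff κ v k = coeff κ (v k) := rfl

/-- In the colexicographic order, for which `dₙ` is the most significant derivation, all the
monomials of `v` are at most `ρ`. -/
def LeadLE (ρ : Fin n →₀ ℕ) (v : Fin m → DiffOp Δ) : Prop :=
  ∀ κ, toColex ρ < toColex κ → vcoeff κ v = 0

/-- In `d_i a = a d_i + ∂_i a` the derivative stays on the old monomial, strictly below the new
leading one, so the leading coefficient does not change. -/
lemma leadLE_d_smul {ρ : Fin n →₀ ℕ} {v : Fin m → DiffOp Δ} (h : LeadLE ρ v) (i : Fin n) :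
    LeadLE (Finsupp.single i 1 + ρ) (d Δ i • v) ∧
      vcoeff (Finsupp.single i 1 + ρ) (d Δ i • v) = vcoeff ρ v := by
  have hlt : toColex ρ < toColex (Finsupp.single i 1 + ρ) := by
    refine lt_of_le_of_ne (Finsupp.toColex_monotone le_add_self) fun h => ?_
    have := DFunLike.congr_fun (toColex.injective h) i
    simp at this
  have h0 : ∀ κ, toColex ρ < toColex κ → ∀ k, coeff κ (v k) = 0 := fun κ hκ k =>
    congrFun (h κ hκ) k
  constructor
  · intro κ hκ
    ext k
    rw [vcoeff_apply, Pi.smul_apply, smul_eq_mul, coeff_d_mul, h0 κ (hlt.trans hκ), map_zero,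
      add_zero]
    split_ifs with hi
    · refine h0 _ ?_ k
      have h1 : toColex (Finsupp.single i 1) + toColex ρ <
          toColex (Finsupp.single i 1) + toColex (κ - Finsupp.single i 1) := by
        rw [← toColex_add, ← toColex_add, add_tsub_cancel_of_le hi]
        exact hκ
      exact lt_of_add_lt_add_left h1
    · rfl
  · ext k
    rw [vcoeff_apply, Pi.smul_apply, smul_eq_mul, coeff_d_mul, if_pos le_self_add,
      add_tsub_cancel_left, h0 _ hlt, map_zero, add_zero]
    rfl

lemma leadLE_mono_smul {ρ : Fin n →₀ ℕ} {v : Fin m → DiffOp Δ} (h : LeadLE ρ v)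
    (μ : Fin n →₀ ℕ) :
    LeadLE (μ + ρ) ((mono μ 1 : DiffOp Δ) • v) ∧
      vcoeff (μ + ρ) ((mono μ 1 : DiffOp Δ) • v) = vcoeff ρ v := by
  induction μ using Finsupp.induction_linear generalizing ρ v with
  | zero => simpa [← one_def] using h
  | add μ ν hμ hν =>
    rw [← mono_one_mul_mono_one, mul_smul, add_assoc, ← (hν h).2]
    exact hμ (hν h).1
  | single i k =>
    induction k generalizing ρ v with
    | zero => simpa [← one_def] using h
    | succ k ih =>
      rw [Finsupp.single_add, ← mono_one_mul_mono_one, mul_smul, add_assoc,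
        ← (leadLE_d_smul h i).2]
      exact ih (leadLE_d_smul h i).1

/-- Elimination property of the order: the last place where two multi-indices differ decides, and
nothing lies below `0` there. -/
lemma eq_zero_of_colex_le {κ ρ : Fin n →₀ ℕ} (h : toColex κ ≤ toColex ρ) {s : ℕ}
    (hρ : ∀ j : Fin n, s ≤ j.val → ρ j = 0) : ∀ j : Fin n, s ≤ j.val → κ j = 0 := by
  intro j hj
  rcases h.eq_or_lt with h | h
  · rw [toColex.injective h, hρ j hj]
  · obtain ⟨i, h1, h2⟩ := Finsupp.Colex.lt_iff.mp h
    change ∀ j, i < j → κ j = ρ j at h1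
    change κ i < ρ i at h2
    rw [h1 j, hρ j hj]
    by_contra hij
    rw [hρ i (hj.trans (not_lt.mp hij))] at h2
    omega

/-- A nonzero multi-index is `μ + 1ᵢ`, with `i` its last nonzero place. -/
lemma exists_eq_add_single {ρ : Fin n →₀ ℕ} (hρ : ρ ≠ 0) :
    ∃ (i : Fin n) (μ : Fin n →₀ ℕ), ρ = μ + Finsupp.single i 1 ∧ ∀ j, i < j → μ j = 0 := by
  obtain ⟨i, hi, hmax⟩ := Finset.exists_max_image ρ.support id (Finsupp.support_nonempty_iff.mpr hρ)
  have hle : Finsupp.single i 1 ≤ ρ := by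
    rw [Finsupp.single_le_iff]
    exact Nat.one_le_iff_ne_zero.mpr (Finsupp.mem_support_iff.mp hi)
  refine ⟨i, ρ - Finsupp.single i 1, (tsub_add_cancel_of_le hle).symm, fun j hj => ?_⟩
  have : ρ j = 0 := by
    by_contra h
    exact absurd (hmax j (Finsupp.mem_support_iff.mpr h)) (not_le.mpr hj)
  simp [this]

/-- Both `i` and `j` are the last nonzero place of the common sum. This is why multiplicative
prolongations with the same leading monomial share class and multi-index. -/
lemma add_single_inj {μ ν : Fin n →₀ ℕ} {i j : Fin n} (hμ : ∀ l, i < l → μ l = 0)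
    (hν : ∀ l, j < l → ν l = 0) (h : μ + Finsupp.single i 1 = ν + Finsupp.single j 1) :
    i = j ∧ μ = ν := by
  have key : i = j := by
    have h1 := DFunLike.congr_fun h i
    have h2 := DFunLike.congr_fun h j
    simp only [Finsupp.add_apply, Finsupp.single_apply] at h1 h2
    rcases lt_trichotomy i j with hij | hij | hij
    · rw [hμ j hij, if_neg hij.ne] at h2
      simp at h2
    · exact hij
    · rw [hν i hij, if_neg hij.ne] at h1
      simp at h1
  subst key
  exact ⟨rfl, add_right_cancel h⟩

end

end DiffOp

/-! ### Prolongations of the equations and their leading terms -/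

namespace FirstOrderSystem

noncomputable section

open DiffOp

variable {n m p : ℕ} {K : Type*} [Field K] (R : FirstOrderSystem K n m p)
  (Δ : CommDerivations n K)

/-- The prolongation `d_μ Φ^τ` of an equation. -/
def prolong (x : Fin p × (Fin n →₀ ℕ)) : Fin m → DiffOp Δ :=
  (mono x.2 1 : DiffOp Δ) • R.eqn Δ x.1

/-- The leading monomial of a prolongation. -/
def lead (x : Fin p × (Fin n →₀ ℕ)) : Fin n →₀ ℕ := x.2 + Finsupp.single (R.cls x.1) 1

/-- The prolongation is with respect to multiplicative variables only. -/
def Mult (x : Fin p × (Fin n →₀ ℕ)) : Prop := ∀ j, R.cls x.1 < j → x.2 j = 0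

variable {R Δ}

lemma prolong_zero (τ : Fin p) : R.prolong Δ (τ, 0) = R.eqn Δ τ := by
  simp [prolong, ← one_def]

lemma mono_smul_prolong (μ : Fin n →₀ ℕ) (x : Fin p × (Fin n →₀ ℕ)) :
    (mono μ 1 : DiffOp Δ) • R.prolong Δ x = R.prolong Δ (x.1, μ + x.2) := by
  rw [prolong, smul_smul, mono_one_mul_mono_one, prolong]

lemma vcoeff_eqn (τ : Fin p) (κ : Fin n →₀ ℕ) (k : Fin m) :
    vcoeff κ (R.eqn Δ τ) k =
      (∑ i, if Finsupp.single i 1 = κ then R.a τ i k else 0) + if 0 = κ then R.b τ k else 0 := by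
  simp only [vcoeff_apply, eqn, map_add, map_sum, map_smul, d_eq_mono, C, coeff_mono, smul_eq_mul,
    mul_ite, mul_one, mul_zero]

lemma leadLE_eqn (τ : Fin p) : LeadLE (Finsupp.single (R.cls τ) 1) (R.eqn Δ τ) := by
  intro κ hκ
  ext k
  rw [vcoeff_eqn, if_neg, Finset.sum_eq_zero]
  · simp
  · intro i _
    split_ifs with h
    · subst h
      exact R.a_eq_zero τ i (Finsupp.Colex.single_lt_iff.mp hκ) k
    · rfl
  · rintro rfl
    exact absurd (Finsupp.toColex_monotone (zero_le (a := Finsupp.single (R.cls τ) 1))) (not_le.mpr hκ)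

lemma vcoeff_single_eqn (τ : Fin p) :
    vcoeff (Finsupp.single (R.cls τ) 1) (R.eqn Δ τ) = R.a τ (R.cls τ) := by
  ext k
  rw [vcoeff_eqn, if_neg, Finset.sum_eq_single (R.cls τ)]
  · simp
  · intro i _ hi
    rw [if_neg]
    intro h
    exact hi (Finsupp.single_left_injective one_ne_zero h)
  · simp
  · intro h
    have := DFunLike.congr_fun h (R.cls τ)
    simp at this

lemma leadLE_prolong (x : Fin p × (Fin n →₀ ℕ)) : LeadLE (R.lead x) (R.prolong Δ x) :=
  (leadLE_mono_smul (leadLE_eqn x.1) x.2).1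

lemma vcoeff_lead_prolong (x : Fin p × (Fin n →₀ ℕ)) :
    vcoeff (R.lead x) (R.prolong Δ x) = R.a x.1 (R.cls x.1) :=
  (leadLE_mono_smul (leadLE_eqn x.1) x.2).2.trans (vcoeff_single_eqn x.1)

/-- The leading coefficients of a combination of multiplicative prolongations. -/
lemma vcoeff_linearCombination (c : (Fin p × (Fin n →₀ ℕ)) →₀ K) {i : Fin n} {μ : Fin n →₀ ℕ}
    (hμ : ∀ j, i < j → μ j = 0) (hc : ∀ x ∈ c.support, R.Mult x)
    (hle : ∀ x ∈ c.support, toColex (R.lead x) ≤ toColex (μ + Finsupp.single i 1)) :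
    vcoeff (μ + Finsupp.single i 1) (Finsupp.linearCombination K (R.prolong Δ) c) =
      ∑ τ : {τ : Fin p // R.cls τ = i}, c (τ.val, μ) • R.a τ i := by
  classical
  set ρ := μ + Finsupp.single i 1 with hρ
  let T : Finset (Fin p × (Fin n →₀ ℕ)) :=
    Finset.univ.image fun τ : {τ : Fin p // R.cls τ = i} => (τ.val, μ)
  have h1 : ∑ τ : {τ : Fin p // R.cls τ = i}, c (τ.val, μ) • R.a τ i =
      ∑ x ∈ T, c x • vcoeff ρ (R.prolong Δ x) := by
    rw [Finset.sum_image]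
    · refine Finset.sum_congr rfl fun τ _ => ?_
      have : ρ = R.lead (τ.val, μ) := by rw [hρ, lead, τ.2]
      rw [this, vcoeff_lead_prolong, τ.2]
    · intro a _ b _ hab
      exact Subtype.ext (Prod.ext_iff.mp hab).1
  rw [h1, Finsupp.linearCombination_apply, Finsupp.sum, map_sum]
  simp only [map_smul]
  -- Both sums are extended to the union of the two index sets: off the support the scalar vanishes,
  -- and off `T` the prolongation leads strictly below `ρ`.
  refine (Finset.sum_subset (Finset.subset_union_left (s₂ := T)) ?_).trans
    (Finset.sum_subset (Finset.subset_union_right (s₁ := c.support)) ?_).symm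
  · intro x _ hx
    rw [Finsupp.notMem_support_iff.mp hx, zero_smul]
  · intro x hx hxT
    have hxc : x ∈ c.support := (Finset.mem_union.mp hx).resolve_right hxT
    rw [leadLE_prolong x ρ, smul_zero]
    refine lt_of_le_of_ne (hle x hxc) fun h => hxT ?_
    obtain ⟨h2, h3⟩ := add_single_inj (hc x hxc) hμ (toColex.injective h)
    exact Finset.mem_image.mpr ⟨⟨x.1, h2⟩, Finset.mem_univ _, Prod.ext rfl h3.symm⟩

/-- The leading terms of the multiplicative prolongations cannot cancel. -/
lemma exists_lead_of_linearCombination (c : (Fin p × (Fin n →₀ ℕ)) →₀ K)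
    (hc : ∀ x ∈ c.support, R.Mult x) (h0 : c ≠ 0) :
    ∃ x ∈ c.support, (∀ y ∈ c.support, toColex (R.lead y) ≤ toColex (R.lead x)) ∧
      vcoeff (R.lead x) (Finsupp.linearCombination K (R.prolong Δ) c) ≠ 0 := by
  obtain ⟨x, hx, hmax⟩ := Finset.exists_max_image c.support (fun x => toColex (R.lead x))
    (Finsupp.support_nonempty_iff.mpr h0)
  refine ⟨x, hx, hmax, fun h => ?_⟩
  rw [lead, vcoeff_linearCombination c (hc x hx) hc hmax] at h
  -- The coefficient at the top monomial is a combination of rows of a single class, so independence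
  -- would make the scalar at `x` vanish.
  have := Fintype.linearIndependent_iff.mp (R.solvable (R.cls x.1)) (fun τ => c (τ.val, x.2)) h
    ⟨x.1, rfl⟩
  exact Finsupp.mem_support_iff.mp hx this

/-- Without cancellation at the top, a bound on the sum bounds each of its terms. -/
lemma lead_le_of_leadLE {c : (Fin p × (Fin n →₀ ℕ)) →₀ K} (hc : ∀ x ∈ c.support, R.Mult x)
    {ρ : Fin n →₀ ℕ} (h : LeadLE ρ (Finsupp.linearCombination K (R.prolong Δ) c)) :
    ∀ x ∈ c.support, toColex (R.lead x) ≤ toColex ρ := by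
  by_cases h0 : c = 0
  · simp [h0]
  · obtain ⟨x, -, hmax, hne⟩ := exists_lead_of_linearCombination (Δ := Δ) c hc h0
    intro y hy
    by_contra hlt
    exact hne (h _ ((not_le.mp hlt).trans_le (hmax y hy)))

end

end FirstOrderSystem

/-! ### Involution: multiplicative prolongations suffice -/

namespace DiffOp

noncomputable section

variable {n m : ℕ} {K : Type*} [Field K] {Δ : CommDerivations n K}

lemma C_smul (a : K) (v : Fin m → DiffOp Δ) : C Δ a • v = a • v := by
  ext1 k
  exact C_mul a (v k)

lemma smul_eq_sum (P : DiffOp Δ) (v : Fin m → DiffOp Δ) :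
    P • v = ∑ κ ∈ Finsupp.support P, coeff κ P • ((mono κ 1 : DiffOp Δ) • v) := by
  conv_lhs => rw [← sum_mono P]
  rw [Finset.sum_smul]
  refine Finset.sum_congr rfl fun κ _ => ?_
  rw [mono_eq_smul, ← C_mul, mul_smul, C_smul]

lemma mono_mem_box (μ : Fin n →₀ ℕ) (a : K) : (mono μ a : DiffOp Δ) ∈ box Δ μ := by
  refine mem_box.mpr fun ν hν => le_of_eq ?_
  rw [coeff_mono] at hν
  by_contra hne
  exact hν (if_neg (Ne.symm hne))

/-- Moving a coefficient to the left of `d_μ` produces only monomials dividing `d_μ`. -/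
lemma mono_smul_smul_mem (μ : Fin n →₀ ℕ) (a : K) (v : Fin m → DiffOp Δ)
    {N : Submodule K (Fin m → DiffOp Δ)} (h : ∀ ν ≤ μ, (mono ν 1 : DiffOp Δ) • v ∈ N) :
    (mono μ 1 : DiffOp Δ) • a • v ∈ N := by
  have hbox : (mono μ 1 * C Δ a : DiffOp Δ) ∈ box Δ μ := by
    have h1 := mul_mem_box (mono_mem_box (Δ := Δ) μ 1) (mono_mem_box 0 a)
    rwa [add_zero] at h1
  rw [← C_smul, smul_smul, smul_eq_sum]
  exact N.sum_mem fun κ hκ => N.smul_mem _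
    (h κ (mem_box.mp hbox κ (Finsupp.mem_support_iff.mp hκ)))

end

end DiffOp

namespace FirstOrderSystem

noncomputable section

open DiffOp

variable {n m p : ℕ} {K : Type*} [Field K] {R : FirstOrderSystem K n m p}
  {Δ : CommDerivations n K}

/-- In an involutive system every prolongation is a combination of multiplicative ones whose
leading monomials are not larger. -/
theorem IsInvolutive.prolong_mem_span (hR : R.IsInvolutive Δ) (x : Fin p × (Fin n →₀ ℕ)) :
    R.prolong Δ x ∈ Submodule.span K
      (R.prolong Δ '' {y | R.Mult y ∧ toColex (R.lead y) ≤ toColex (R.lead x)}) := by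
  -- Rewriting either lowers the leading monomial or keeps it and raises the class; the order dual
  -- turns the latter into descent.
  let f : Fin p × (Fin n →₀ ℕ) → Colex (Fin n →₀ ℕ) ×ₗ (Fin n)ᵒᵈ := fun y =>
    toLex (toColex (R.lead y), OrderDual.toDual (R.cls y.1))
  induction x using (InvImage.wf f wellFounded_lt).induction with
  | _ x ih =>
  obtain ⟨σ, μ⟩ := x
  by_cases hmult : R.Mult (σ, μ)
  · exact Submodule.subset_span ⟨_, ⟨hmult, le_rfl⟩, rfl⟩
  unfold Mult at hmult
  push Not at hmult
  obtain ⟨j, hj, hμj⟩ := hmult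
  obtain ⟨μ', rfl⟩ : ∃ μ', μ = μ' + Finsupp.single j 1 := by
    refine ⟨μ - Finsupp.single j 1, (tsub_add_cancel_of_le ?_).symm⟩
    rw [Finsupp.single_le_iff]
    exact Nat.one_le_iff_ne_zero.mpr hμj
  set ρ₀ := Finsupp.single j 1 + Finsupp.single (R.cls σ) 1 with hρ₀
  have hlead : R.lead (σ, μ' + Finsupp.single j 1) = μ' + ρ₀ := add_assoc _ _ _
  have hmem : d Δ j • R.eqn Δ σ ∈ Submodule.span K (R.prolong Δ '' {y | R.Mult y}) := by
    refine Submodule.span_mono ?_ (hR σ j)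
    rintro _ (⟨ρ, rfl⟩ | ⟨ρ, l, hl, rfl⟩)
    · exact ⟨(ρ, 0), fun _ _ => rfl, prolong_zero ρ⟩
    · refine ⟨(ρ, Finsupp.single l 1), fun i hi => ?_, rfl⟩
      exact Finsupp.single_eq_of_ne (hl.trans_lt hi).ne'
  obtain ⟨c, hc, hceq⟩ := (Finsupp.mem_span_image_iff_linearCombination K).mp hmem
  replace hc : ∀ y ∈ c.support, R.Mult y := fun y hy => hc hy
  have hle : ∀ y ∈ c.support, toColex (R.lead y) ≤ toColex ρ₀ := by
    refine lead_le_of_leadLE hc (Δ := Δ) ?_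
    rw [hceq]
    exact (leadLE_d_smul (leadLE_eqn σ) j).1
  have hx : R.prolong Δ (σ, μ' + Finsupp.single j 1) =
      ∑ y ∈ c.support, (mono μ' 1 : DiffOp Δ) • c y • R.prolong Δ y := by
    rw [← Finset.smul_sum]
    change _ = (mono μ' 1 : DiffOp Δ) • c.sum fun y a => a • R.prolong Δ y
    rw [← Finsupp.linearCombination_apply, hceq, smul_smul, d_eq_mono, mono_one_mul_mono_one]
    rfl
  rw [hx]
  -- The scalars `c y` do not commute with `d_{μ'}`; moving them left only creates divisors `d_ν`,
  -- whose leading monomials are no larger.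
  refine Submodule.sum_mem _ fun y hy => mono_smul_smul_mem _ _ _ fun ν hν => ?_
  rw [mono_smul_prolong]
  have hly : R.lead (y.1, ν + y.2) = ν + R.lead y := add_assoc _ _ _
  have hle1 : toColex (ν + R.lead y) ≤ toColex (μ' + R.lead y) :=
    Finsupp.toColex_monotone (add_le_add_left hν _)
  have hle2 : toColex (μ' + R.lead y) ≤ toColex (μ' + ρ₀) := by
    rw [toColex_add, toColex_add]
    exact add_le_add_right (hle y hy) _
  have hlt : f (y.1, ν + y.2) < f (σ, μ' + Finsupp.single j 1) := by
    rw [Prod.Lex.lt_iff]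
    simp only [f, ofLex_toLex, hly, hlead]
    rcases (hle1.trans hle2).lt_or_eq with h | h
    · exact Or.inl h
    -- Equality forces `y` to lead with `d_j d_{cls σ}`. As `y` is multiplicative, its class is the
    -- last place there, namely `j > cls σ`.
    · refine Or.inr ⟨h, ?_⟩
      have h2 := toColex.injective (le_antisymm hle2 (h ▸ hle1))
      have h3 : y.2 + Finsupp.single (R.cls y.1) 1 = Finsupp.single (R.cls σ) 1 +
          Finsupp.single j 1 := by
        rw [add_comm (Finsupp.single (R.cls σ) 1)]
        exact add_left_cancel h2
      have h4 := (add_single_inj (hc y hy) (fun l hl =>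
        Finsupp.single_eq_of_ne (hj.trans hl).ne') h3).1
      rw [h4]
      exact OrderDual.toDual_lt_toDual.mpr hj
  refine Submodule.span_mono (Set.image_mono ?_) (ih _ hlt)
  rintro z ⟨hz1, hz2⟩
  refine ⟨hz1, hz2.trans ?_⟩
  rw [hly, hlead]
  exact hle1.trans hle2

lemma eqn_mem_equations (τ : Fin p) {c : ℕ → Prop} (h : c (R.classNum τ)) :
    R.eqn Δ τ ∈ R.equations Δ c := Submodule.subset_span ⟨τ, h, rfl⟩

lemma prolong_mem_equations (x : Fin p × (Fin n →₀ ℕ)) {c : ℕ → Prop} (h : c (R.classNum x.1)) :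
    R.prolong Δ x ∈ R.equations Δ c := Submodule.smul_mem _ _ (eqn_mem_equations _ h)

/-- The equations of an involutive system are spanned over `K` by the multiplicative
prolongations. -/
lemma IsInvolutive.exists_linearCombination (hR : R.IsInvolutive Δ) {c : ℕ → Prop}
    {v : Fin m → DiffOp Δ} (hv : v ∈ R.equations Δ c) :
    ∃ c : (Fin p × (Fin n →₀ ℕ)) →₀ K, (∀ x ∈ c.support, R.Mult x) ∧
      Finsupp.linearCombination K (R.prolong Δ) c = v := by
  suffices h : v ∈ Submodule.span K (R.prolong Δ '' {y | R.Mult y}) by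
    obtain ⟨c, hc, h⟩ := (Finsupp.mem_span_image_iff_linearCombination K).mp h
    exact ⟨c, fun x hx => hc hx, h⟩
  obtain ⟨N, f, g, rfl⟩ := Submodule.mem_span_set'.mp hv
  refine Submodule.sum_mem _ fun i _ => ?_
  obtain ⟨τ, -, h⟩ := (g i).2
  rw [h, smul_eq_sum]
  exact Submodule.sum_mem _ fun κ _ => Submodule.smul_mem _ _
    (Submodule.span_mono (Set.image_mono fun _ h => h.1) (hR.prolong_mem_span (τ, κ)))

/-! ### Elimination to the first `s` derivations -/

/-- The inclusion of `K[d₁, …, dₛ]ᵐ` into `Dᵐ`. -/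
def inclFirst (Δ : CommDerivations n K) (s m : ℕ) :
    (Fin m → firstVars Δ s) →ₗ[firstVars Δ s] (Fin m → DiffOp Δ) where
  toFun u k := u k
  map_add' _ _ := rfl
  map_smul' _ _ := rfl

lemma inclFirst_injective (s : ℕ) : Function.Injective (inclFirst Δ s m) := fun _ _ h =>
  funext fun k => Subtype.ext (congrFun h k)

lemma mono_mem_firstVars {s : ℕ} {μ : Fin n →₀ ℕ} (hμ : ∀ j : Fin n, s ≤ j.val → μ j = 0)
    (a : K) : (mono μ a : DiffOp Δ) ∈ firstVars Δ s := by
  intro κ hκ j hj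
  have := mem_box.mp (mono_mem_box μ a) κ hκ j
  rw [hμ j hj] at this
  omega

lemma lead_first_iff {x : Fin p × (Fin n →₀ ℕ)} {s : ℕ} :
    (∀ j : Fin n, s ≤ j.val → R.lead x j = 0) ↔
      R.classNum x.1 ≤ s ∧ ∀ j : Fin n, s ≤ j.val → x.2 j = 0 := by
  constructor
  · intro h
    constructor
    · by_contra hlt
      unfold classNum at hlt
      have := h (R.cls x.1) (by omega)
      simp [lead] at this
    · intro j hj
      have := h j hj
      rw [lead, Finsupp.add_apply] at this
      omega
  · rintro ⟨h1, h2⟩ j hj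
    rw [lead, Finsupp.add_apply, h2 j hj, Finsupp.single_eq_of_ne, zero_add]
    rintro rfl
    unfold classNum at h1
    omega

/-- The prolongation of an equation of class at most `s` as an element of `K[d₁, …, dₛ]ᵐ`. -/
lemma smul_prolong_eq_inclFirst {s : ℕ} {x : Fin p × (Fin n →₀ ℕ)}
    (h : R.classNum x.1 ≤ s) (hx : ∀ j : Fin n, s ≤ j.val → x.2 j = 0) (a : K) :
    a • R.prolong Δ x = inclFirst Δ s m
      ((⟨mono x.2 a, mono_mem_firstVars hx a⟩ : firstVars Δ s) • R.eqnFirst Δ x.1 h) := by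
  ext1 k
  change a • (mono x.2 1 * R.eqn Δ x.1 k) = mono x.2 a * R.eqn Δ x.1 k
  rw [mono_eq_smul x.2 a, smul_mul_assoc]

/-- A combination of prolongations of class at most `s` by the first `s` derivations. -/
lemma exists_inclFirst_eq_linearCombination {s : ℕ} (c : (Fin p × (Fin n →₀ ℕ)) →₀ K)
    {q : ℕ → Prop} (hq : ∀ i, q i → i ≤ s)
    (hc : ∀ x ∈ c.support, q (R.classNum x.1) ∧ ∀ j : Fin n, s ≤ j.val → x.2 j = 0) :
    ∃ u ∈ Submodule.span (firstVars Δ s)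
        {Ψ | ∃ τ, ∃ h : q (R.classNum τ), Ψ = R.eqnFirst Δ τ (hq _ h)},
      inclFirst Δ s m u = Finsupp.linearCombination K (R.prolong Δ) c := by
  refine ⟨∑ x ∈ c.support.attach, (⟨mono x.1.2 (c x), mono_mem_firstVars (hc x.1 x.2).2 _⟩ :
    firstVars Δ s) • R.eqnFirst Δ x.1.1 (hq _ (hc x.1 x.2).1), ?_, ?_⟩
  · exact Submodule.sum_mem _ fun x _ => Submodule.smul_mem _ _
      (Submodule.subset_span ⟨_, (hc x.1 x.2).1, rfl⟩)
  · rw [map_sum, Finsupp.linearCombination_apply, Finsupp.sum, ← Finset.sum_attach c.support]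
    exact Finset.sum_congr rfl fun x _ => (smul_prolong_eq_inclFirst (hq _ (hc x.1 x.2).1)
      (hc x.1 x.2).2 _).symm

lemma inclFirst_mem_equations {s : ℕ} {q : ℕ → Prop} (hq : ∀ i, q i → i ≤ s)
    {u : Fin m → firstVars Δ s} (hu : u ∈ Submodule.span (firstVars Δ s)
      {Ψ | ∃ τ, ∃ h : q (R.classNum τ), Ψ = R.eqnFirst Δ τ (hq _ h)}) :
    inclFirst Δ s m u ∈ R.equations Δ q := by
  suffices h : Submodule.span (firstVars Δ s)
      {Ψ | ∃ τ, ∃ h : q (R.classNum τ), Ψ = R.eqnFirst Δ τ (hq _ h)} ≤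
      ((R.equations Δ q).restrictScalars (firstVars Δ s)).comap (inclFirst Δ s m) from h hu
  refine Submodule.span_le.mpr ?_
  rintro _ ⟨τ, h, rfl⟩
  exact eqn_mem_equations τ h

/-- An element of `K[d₁, …, dₛ]ᵐ` that is a consequence of the system is already a consequence over
`K[d₁, …, dₛ]` of the equations of class at most `s`. -/
lemma IsInvolutive.mem_span_eqnFirst (hR : R.IsInvolutive Δ) {s : ℕ} {u : Fin m → firstVars Δ s} :
    inclFirst Δ s m u ∈ R.equations Δ (fun _ => True) ↔
      u ∈ Submodule.span (firstVars Δ s)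
        {Ψ : Fin m → firstVars Δ s | ∃ τ, ∃ h : R.classNum τ ≤ s, Ψ = R.eqnFirst Δ τ h} := by
  constructor
  · intro h
    obtain ⟨c, hc, hcu⟩ := hR.exists_linearCombination h
    obtain ⟨w, hw, hwu⟩ := exists_inclFirst_eq_linearCombination (R := R) (Δ := Δ) (s := s) c
      (q := fun i => i ≤ s) (fun _ h => h) (by
        intro x hx
        -- The largest leading monomial survives in `u`, so it is free of the derivations after the
        -- first `s`; by elimination so are all the others.
        obtain ⟨y, -, hmax, hne⟩ := exists_lead_of_linearCombination (Δ := Δ) c hc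
          (by rintro rfl; simp at hx)
        refine lead_first_iff.mp (eq_zero_of_colex_le (hmax x hx) ?_)
        rw [hcu] at hne
        obtain ⟨k, hk⟩ := Function.ne_iff.mp hne
        exact (u k).2 _ hk)
    rw [hcu] at hwu
    exact inclFirst_injective s hwu ▸ hw
  · intro h
    refine Submodule.span_mono ?_ (inclFirst_mem_equations (q := fun i => i ≤ s) (fun _ h => h) h)
    rintro _ ⟨τ, -, rfl⟩
    exact ⟨τ, trivial, rfl⟩

end

end FirstOrderSystem

/-! ### Left fractions and linear dependence over an Ore domain -/

namespace OreLocalization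

open nonZeroDivisors

section

variable {A : Type*} [Ring A] {S : Submonoid A} [OreSet S] {X : Type*} [AddCommGroup X] [Module A X]

/-- Finitely many left fractions have a common denominator. -/
lemma exists_common_denom {ι : Type*} [Finite ι] (f : ι → OreLocalization S X) :
    ∃ (s : S) (P : ι → X), ∀ i, f i = P i /ₒ s := by
  classical
  have := Fintype.ofFinite ι
  suffices h : ∀ T : Finset ι, ∃ (s : S) (P : ι → X), ∀ i ∈ T, f i = P i /ₒ s by
    obtain ⟨s, P, h⟩ := h Finset.univ
    exact ⟨s, P, fun i => h i (Finset.mem_univ i)⟩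
  intro T
  induction T using Finset.induction_on with
  | empty => exact ⟨1, 0, by simp⟩
  | insert j T hj ih =>
    obtain ⟨s, P, h⟩ := ih
    obtain ⟨r, t, hrt⟩ : ∃ r t, f j = r /ₒ t := by
      induction f j using OreLocalization.ind with
      | _ r t => exact ⟨r, t, rfl⟩
    -- The Ore condition gives a common left multiple `b s = a t` of the two denominators.
    obtain ⟨a, b, hab⟩ : ∃ (a : A) (b : S), (b : A) * s = a * t :=
      ⟨oreNum (s : A) t, oreDenom (s : A) t, ore_eq (s : A) t⟩
    have hmem : a * (t : A) ∈ S := hab ▸ (b * s).2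
    refine ⟨b * s, fun i => if i = j then a • r else (b : A) • P i, fun i hi => ?_⟩
    have e : b * s = ⟨a * t, hmem⟩ := Subtype.ext hab
    by_cases hij : i = j
    · subst hij
      simp only [if_true]
      rw [hrt, OreLocalization.expand r t a hmem, e]
    · simp only [if_neg hij]
      rw [h i ((Finset.mem_insert.mp hi).resolve_left hij),
        OreLocalization.expand' (P i) s b]
      rfl

lemma oreDiv_one_add (x y : X) : (x + y) /ₒ (1 : S) = x /ₒ 1 + y /ₒ 1 := add_oreDiv.symm

lemma smul_oreDiv_one_eq (P : A) (x : X) :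
    (P • x) /ₒ (1 : S) = (numeratorHom P : OreLocalization S A) • (x /ₒ (1 : S)) := by
  rw [numeratorHom_apply, smul_div_one]

lemma oreDiv_eq_smul (x : X) (s : S) :
    x /ₒ s = ((1 : A) /ₒ s : OreLocalization S A) • (x /ₒ (1 : S)) := by
  rw [smul_div_one, one_smul]

lemma oreDiv_one_eq_zero_iff {x : X} : x /ₒ (1 : S) = 0 ↔ ∃ t : S, (t : A) • x = 0 := by
  constructor
  · intro h
    rw [OreLocalization.zero_def, oreDiv_eq_iff] at h
    obtain ⟨u, v, h1, h2⟩ := h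
    rw [smul_zero] at h1
    refine ⟨u, ?_⟩
    simp only [OneMemClass.coe_one, mul_one] at h2
    rw [h2, ← h1]
  · rintro ⟨t, ht⟩
    rw [OreLocalization.expand' x 1 t]
    change ((t : A) • x) /ₒ _ = 0
    rw [ht, zero_oreDiv]

end

section Domain

variable {A : Type*} [Ring A] [OreSet A⁰]

lemma numeratorHom_injective :
    Function.Injective (numeratorHom : A →* OreLocalization A⁰ A) :=
  numeratorHom_inj fun _ h => (mem_nonZeroDivisors_iff.mp h).1

lemma numeratorHom_add (P Q : A) :
    (numeratorHom (P + Q) : OreLocalization A⁰ A) = numeratorHom P + numeratorHom Q :=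
  oreDiv_one_add P Q

lemma numeratorHom_sum {ι : Type*} (T : Finset ι) (P : ι → A) :
    (numeratorHom (∑ i ∈ T, P i) : OreLocalization A⁰ A) = ∑ i ∈ T, numeratorHom (P i) :=
  map_sum (AddMonoidHom.mk' (fun P : A => (numeratorHom P : OreLocalization A⁰ A))
    numeratorHom_add) P T

lemma numeratorHom_zero : (numeratorHom (0 : A) : OreLocalization A⁰ A) = 0 :=
  zero_oreDiv 1

/-- More than `m` rows of length `m` over a left Ore domain are linearly dependent. -/
lemma exists_row_relation [Nontrivial A] [NoZeroDivisors A] {ι κ : Type*} [Fintype ι] [Fintype κ]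
    (hcard : Fintype.card κ < Fintype.card ι) (Q : ι → κ → A) :
    ∃ P : ι → A, P ≠ 0 ∧ ∀ j, ∑ i, P i * Q i j = 0 := by
  have hdep : ¬ LinearIndependent (OreLocalization A⁰ A)
      fun i => (fun j => numeratorHom (Q i j) : κ → OreLocalization A⁰ A) := by
    intro h
    have := h.fintype_card_le_finrank
    rw [Module.finrank_fintype_fun_eq_card] at this
    omega
  obtain ⟨g, hg, i₀, hi₀⟩ := Fintype.not_linearIndependent_iff.mp hdep
  obtain ⟨s, P, hP⟩ := exists_common_denom g
  refine ⟨P, ?_, fun j => ?_⟩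
  · rintro rfl
    exact hi₀ (by rw [hP]; exact zero_oreDiv s)
  · apply numeratorHom_injective
    have h := congrFun hg j
    rw [Finset.sum_apply] at h
    simp only [Pi.smul_apply, smul_eq_mul, Pi.zero_apply] at h
    rw [numeratorHom_sum, numeratorHom_zero]
    -- Multiplication on the left by the common denominator `s` of the scalars `g i` clears it from
    -- the relation over the skew field.
    have h1 : (numeratorHom (s : A) : OreLocalization A⁰ A) * ∑ i, g i * numeratorHom (Q i j) =
        ∑ i, numeratorHom (P i * Q i j) := by
      rw [Finset.mul_sum]
      refine Finset.sum_congr rfl fun i _ => ?_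
      rw [← mul_assoc, hP, map_mul, numeratorHom_apply, OreLocalization.mul_cancel,
        ← numeratorHom_apply]
    rw [← h1, h, mul_zero]

end Domain

end OreLocalization

/-! ### Redundancy of the equations of lower class -/

namespace FirstOrderSystem

noncomputable section

open DiffOp nonZeroDivisors

variable {n m p : ℕ} {K : Type*} [Field K] {R : FirstOrderSystem K n m p}
  {Δ : CommDerivations n K}

lemma add_single_first {i₀ : Fin n} {s : ℕ} (hs : i₀.val + 1 = s) {μ : Fin n →₀ ℕ}
    (hμ : ∀ j : Fin n, s ≤ j.val → μ j = 0) (k : ℕ) (j : Fin n) (hj : s ≤ j.val) :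
    (μ + Finsupp.single i₀ k) j = 0 := by
  rw [Finsupp.add_apply, hμ j hj, Finsupp.single_eq_of_ne, zero_add]
  rintro rfl
  omega

/-- Grouping terms by equation yields a row of exactly `p` operators, whatever the number of
prolongations involved. -/
lemma exists_linearCombination_eq_sum_smul {s : ℕ} (c : (Fin p × (Fin n →₀ ℕ)) →₀ K)
    (hc : ∀ x ∈ c.support, ∀ j : Fin n, s ≤ j.val → x.2 j = 0) :
    ∃ Q : Fin p → firstVars Δ s, Finsupp.linearCombination K (R.prolong Δ) c =
      ∑ σ, (Q σ : DiffOp Δ) • R.eqn Δ σ := by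
  classical
  refine ⟨fun σ => ∑ x ∈ c.support.attach, if x.1.1 = σ then
    ⟨mono x.1.2 (c x), mono_mem_firstVars (hc x.1 x.2) _⟩ else 0, ?_⟩
  rw [Finsupp.linearCombination_apply, Finsupp.sum]
  simp only [AddSubmonoidClass.coe_finsetSum, Finset.sum_smul]
  rw [Finset.sum_comm, ← Finset.sum_attach]
  refine Finset.sum_congr rfl fun x _ => ?_
  rw [Finset.sum_eq_single x.1.1]
  · rw [if_pos rfl, prolong, ← C_smul, smul_smul, C_mul, ← mono_eq_smul]
  · intro σ _ hσ
    rw [if_neg (Ne.symm hσ)]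
    exact zero_smul _ _
  · simp

/-- The prolongation `d_s^k Φ^τ` of an equation of class less than `s` is, modulo the
equations of strict class `s`, a combination over `K[d₁, …, d_{s-1}]` of the equations. -/
lemma IsInvolutive.exists_rows (hR : R.IsInvolutive Δ) {i₀ : Fin n} {s : ℕ}
    (hs : i₀.val + 1 = s) {τ : Fin p} (hτ : R.classNum τ ≤ s) (k : ℕ) :
    ∃ (Q : Fin p → firstVars Δ i₀.val), ∃ w ∈ Submodule.span (firstVars Δ s)
        {Ψ : Fin m → firstVars Δ s | ∃ τ, ∃ h : R.classNum τ = s, Ψ = R.eqnFirst Δ τ h.le},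
      (mono (Finsupp.single i₀ k) 1 : DiffOp Δ) • R.eqn Δ τ =
        ∑ σ, (Q σ : DiffOp Δ) • R.eqn Δ σ + inclFirst Δ s m w := by
  classical
  obtain ⟨c, hc, hceq⟩ := (Finsupp.mem_span_image_iff_linearCombination K).mp
    (hR.prolong_mem_span (τ, Finsupp.single i₀ k))
  have hfirst : ∀ x ∈ c.support, R.classNum x.1 ≤ s ∧ ∀ j : Fin n, s ≤ j.val → x.2 j = 0 := by
    intro x hx
    refine lead_first_iff.mp (eq_zero_of_colex_le (hc hx).2 (lead_first_iff.mpr ⟨hτ, ?_⟩))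
    intro j hj
    simpa using add_single_first hs (μ := 0) (fun _ _ => rfl) k j hj
  obtain ⟨w, hw, hweq⟩ := exists_inclFirst_eq_linearCombination (R := R) (Δ := Δ) (s := s)
    (c.filter fun x => R.classNum x.1 = s) (q := fun i => i = s) (fun _ h => h.le) (by
      intro x hx
      rw [Finsupp.support_filter, Finset.mem_filter] at hx
      exact ⟨hx.2, (hfirst x hx.1).2⟩)
  obtain ⟨Q, hQ⟩ := exists_linearCombination_eq_sum_smul (R := R) (Δ := Δ) (s := i₀.val)
    (c.filter fun x => ¬ R.classNum x.1 = s) (by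
      intro x hx j hj
      rw [Finsupp.support_filter, Finset.mem_filter] at hx
      have h1 := (hfirst x hx.1).1
      have h2 := hx.2
      -- A class below `s` has 0-based index below `i₀ = s - 1`, so `d_s` is not multiplicative and
      -- cannot occur in the coefficients.
      refine (hc hx.1).1 j ?_
      unfold classNum at h1 h2
      rw [Fin.lt_def]
      omega)
  refine ⟨Q, w, hw, ?_⟩
  rw [← hQ, hweq, add_comm, ← map_add, Finsupp.filter_add_filter_not]
  exact hceq.symm

/-- Every equation of class at most `s` has a nonzero multiple that is a consequence
of the equations of strict class `s`. -/
theorem IsInvolutive.exists_smul_mem (hR : R.IsInvolutive Δ) {i₀ : Fin n} {s : ℕ}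
    (hs : i₀.val + 1 = s) {τ : Fin p} (hτ : R.classNum τ ≤ s) :
    ∃ P : firstVars Δ s, P ≠ 0 ∧ P • R.eqnFirst Δ τ hτ ∈ Submodule.span (firstVars Δ s)
        {Ψ : Fin m → firstVars Δ s | ∃ τ, ∃ h : R.classNum τ = s, Ψ = R.eqnFirst Δ τ h.le} := by
  -- The `p + 1` powers of `d_s` give one row more than the `p` columns.
  choose Q w hw hQw using fun k : Fin (p + 1) => hR.exists_rows hs hτ k
  obtain ⟨P, hP0, hP⟩ := OreLocalization.exists_row_relation (by simp) Q
  have hsub : ∀ A : firstVars Δ i₀.val, (A : DiffOp Δ) ∈ firstVars Δ s := fun A μ hμ j hj =>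
    A.2 μ hμ j (by omega)
  let E : Fin (p + 1) → firstVars Δ s := fun k => ⟨mono (Finsupp.single i₀ k.val) 1,
    mono_mem_firstVars (fun j hj => by
      simpa using add_single_first hs (μ := 0) (fun _ _ => rfl) k j hj) 1⟩
  let P' : Fin (p + 1) → firstVars Δ s := fun k => ⟨P k, hsub (P k)⟩
  refine ⟨∑ k, P' k * E k, ?_, ?_⟩
  · intro h0
    obtain ⟨k₀, hk₀⟩ := Function.ne_iff.mp hP0
    have hne : (P k₀ : DiffOp Δ) ≠ 0 := fun h => hk₀ (Subtype.ext h)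
    obtain ⟨κ, hκ⟩ : ∃ κ, coeff κ (P k₀ : DiffOp Δ) ≠ 0 := by
      by_contra! h
      exact hne (ext_coeff fun μ => by rw [h, map_zero])
    have h1 := congrArg (fun A : firstVars Δ s =>
      coeff (κ + Finsupp.single i₀ k₀.val) (A : DiffOp Δ)) h0
    simp only [AddSubmonoidClass.coe_finsetSum, map_sum, ZeroMemClass.coe_zero, map_zero] at h1
    -- No `P k` contains `d_s`, so the exponent of `d_s` separates the summands and only `k₀`
    -- contributes.
    rw [Finset.sum_eq_single k₀] at h1
    · change coeff _ ((P k₀ : DiffOp Δ) * mono _ 1) = 0 at h1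
      rw [coeff_mul_mono_one, if_pos le_add_self, add_tsub_cancel_right] at h1
      exact hκ h1
    · intro k _ hk
      change coeff _ ((P k : DiffOp Δ) * mono _ 1) = 0
      rw [coeff_mul_mono_one]
      split_ifs with hle
      · by_contra hne
        have h2 := (P k).2 _ hne i₀ le_rfl
        have h3 := (P k₀).2 _ hκ i₀ le_rfl
        have h4 := hle i₀
        simp only [Finsupp.tsub_apply, Finsupp.add_apply, Finsupp.single_eq_same, h3] at h2 h4
        exact hk (Fin.ext (by omega))
      · rfl
    · simp
  · have key : (∑ k, P' k * E k) • R.eqnFirst Δ τ hτ = ∑ k, P' k • w k := by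
      apply inclFirst_injective s
      rw [map_smul, map_sum]
      simp only [map_smul, Finset.sum_smul]
      have h1 : ∀ k, (P' k * E k) • inclFirst Δ s m (R.eqnFirst Δ τ hτ) =
          ∑ σ, ((P k * Q k σ : firstVars Δ i₀.val) : DiffOp Δ) • R.eqn Δ σ +
            P' k • inclFirst Δ s m (w k) := by
        intro k
        have h2 : E k • inclFirst Δ s m (R.eqnFirst Δ τ hτ) =
            ∑ σ, (Q k σ : DiffOp Δ) • R.eqn Δ σ + inclFirst Δ s m (w k) := hQw k
        rw [mul_smul, h2, smul_add]
        congr 1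
        change (P k : DiffOp Δ) • (∑ σ, (Q k σ : DiffOp Δ) • R.eqn Δ σ) = _
        rw [Finset.smul_sum]
        exact Finset.sum_congr rfl fun σ _ => smul_smul _ _ _
      rw [Finset.sum_congr rfl fun k _ => h1 k, Finset.sum_add_distrib, Finset.sum_comm]
      -- The row relation kills the coefficient of every `Φ^σ`; only the strict class `s` parts `w
      -- k` remain.
      refine add_eq_right.mpr (Finset.sum_eq_zero fun σ _ => ?_)
      rw [← Finset.sum_smul, ← AddSubmonoidClass.coe_finsetSum, hP σ]
      exact zero_smul _ _
    rw [key]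
    exact Submodule.sum_mem _ fun k _ => Submodule.smul_mem _ _ (hw k)

end

end FirstOrderSystem

/-! ### Codimension and principal jets -/

namespace DiffOp

noncomputable section

variable {n m : ℕ} {K : Type*} [Field K] {Δ : CommDerivations n K}

lemma ofOrder_le_box (q : ℕ) :
    ofOrder Δ q ≤ box Δ (Finsupp.equivFunOnFinite.symm fun _ => q) :=
  Finsupp.supported_mono fun μ hμ j => (Finsupp.le_degree j μ).trans hμ

lemma vcoeff_single (κ : Fin n →₀ ℕ) (k : Fin m) (P : DiffOp Δ) :
    vcoeff κ (Pi.single k P : Fin m → DiffOp Δ) = Pi.single k (coeff κ P) :=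
  funext fun k' => Pi.apply_single (fun _ => coeff (Δ := Δ) κ) (fun _ => map_zero _) k _ k'

instance (q : ℕ) : FiniteDimensional K (ofOrder Δ q) :=
  Submodule.finiteDimensional_of_le (ofOrder_le_box q)

instance (q : ℕ) : FiniteDimensional K
    (Submodule.pi Set.univ fun _ : Fin m => ofOrder Δ q) := by
  let f : (Submodule.pi Set.univ fun _ : Fin m => ofOrder Δ q) →ₗ[K] (Fin m → ofOrder Δ q) :=
    { toFun := fun v k => ⟨v.1 k, v.2 k trivial⟩
      map_add' := fun _ _ => rfl
      map_smul' := fun _ _ => rfl }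
  refine FiniteDimensional.of_injective f fun v w h => Subtype.ext (funext fun k => ?_)
  exact congrArg Subtype.val (congrFun h k)

instance (I : Submodule (DiffOp Δ) (Fin m → DiffOp Δ)) (q : ℕ) :
    FiniteDimensional K (filtration I q) :=
  Module.Finite.map _ (I.mkQ.restrictScalars K)

/-- A polynomial that is at least `(t + 1)^(i + 1)` at `nt + 1` for large `t` has degree greater
than `i`. -/
lemma natDegree_gt_of_le_eval (h : Polynomial ℚ) (i n : ℕ)
    (hle : ∀ᶠ t : ℕ in Filter.atTop, ((t : ℚ) + 1) ^ (i + 1) ≤ h.eval ((n * t + 1 : ℕ) : ℚ)) :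
    i < h.natDegree := by
  by_contra hlt
  rw [not_lt] at hlt
  -- If `h` had degree at most `i`, then `g - f` would be monic of degree `i + 1`, hence eventually
  -- positive, against `g ≤ f` at large `t`.
  set f : Polynomial ℚ := h.comp (Polynomial.C (n : ℚ) * Polynomial.X + 1) with hf
  set g : Polynomial ℚ := (Polynomial.X + Polynomial.C 1) ^ (i + 1) with hg
  have hdf : f.natDegree ≤ i := by
    refine Polynomial.natDegree_comp_le.trans (le_trans ?_ hlt)
    refine (Nat.mul_le_mul_left _ (?_ : _ ≤ 1)).trans (mul_one _).le
    compute_degree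
  have hgm : g.Monic := (Polynomial.monic_X_add_C 1).pow _
  have hdg : g.natDegree = i + 1 := by
    rw [hg, (Polynomial.monic_X_add_C 1).natDegree_pow, Polynomial.natDegree_X_add_C, mul_one]
  have hlt' : f.degree < g.degree := Polynomial.degree_lt_degree (by omega)
  have hm : (g - f).Monic := hgm.sub_of_left hlt'
  have hdeg : 0 < (g - f).degree := by
    rw [Polynomial.degree_sub_eq_left_of_degree_lt hlt', ← Polynomial.natDegree_pos_iff_degree_pos]
    omega
  have ht := (g - f).tendsto_atTop_of_leadingCoeff_nonneg hdeg (by rw [hm]; exact zero_le_one)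
  have hev := (ht.comp tendsto_natCast_atTop_atTop).eventually (Filter.eventually_gt_atTop 0)
  obtain ⟨t, h1, h2⟩ := (hle.and hev).exists
  simp only [Function.comp_apply, hg, hf, Polynomial.eval_sub, Polynomial.eval_pow,
    Polynomial.eval_add, Polynomial.eval_X, Polynomial.eval_C, Polynomial.eval_comp,
    Polynomial.eval_mul, Polynomial.eval_one] at h2
  push_cast at h1
  linarith

end

end DiffOp

namespace FirstOrderSystem

noncomputable section

open DiffOp

variable {n m p : ℕ} {K : Type*} [Field K] {R : FirstOrderSystem K n m p}
  {Δ : CommDerivations n K}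

/-- The leading coefficient vector of a consequence of the system is a combination of the
rows of the equations of the class of the leading monomial. -/
lemma IsInvolutive.vcoeff_mem_span (hR : R.IsInvolutive Δ) {v : Fin m → DiffOp Δ}
    (hv : v ∈ R.equations Δ fun _ => True) {i : Fin n} {μ : Fin n →₀ ℕ}
    (hμ : ∀ j, i < j → μ j = 0) (hle : LeadLE (μ + Finsupp.single i 1) v) :
    vcoeff (μ + Finsupp.single i 1) v ∈
      Submodule.span K (Set.range fun τ : {τ : Fin p // R.cls τ = i} => R.a τ i) := by
  obtain ⟨c, hc, rfl⟩ := hR.exists_linearCombination hv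
  rw [vcoeff_linearCombination c hμ hc (lead_le_of_leadLE hc hle)]
  exact Submodule.sum_mem _ fun τ _ => Submodule.smul_mem _ _ (Submodule.subset_span ⟨τ, rfl⟩)

/-- If the jets of class `i` are not all principal, the dimension of the filtration grows like
a polynomial of degree at least `i` (with classes counted from `1`). -/
lemma IsInvolutive.pow_le_finrank_filtration (hR : R.IsInvolutive Δ) {i : Fin n}
    (h : Submodule.span K (Set.range fun τ : {τ : Fin p // R.cls τ = i} => R.a τ i) ≠ ⊤) (t : ℕ) :
    (t + 1) ^ (i.val + 1) ≤
      Module.finrank K (filtration (R.equations Δ fun _ => True) (n * t + 1)) := by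
  classical
  obtain ⟨k, hk⟩ : ∃ k, Pi.single k 1 ∉
      Submodule.span K (Set.range fun τ : {τ : Fin p // R.cls τ = i} => R.a τ i) := by
    by_contra! hall
    refine h (top_unique ?_)
    rw [← (Pi.basisFun K (Fin m)).span_eq]
    refine Submodule.span_le.mpr ?_
    rintro _ ⟨k, rfl⟩
    rw [Pi.basisFun_apply]
    exact hall k
  -- There are `i + 1` free exponents with `t + 1` values each. Total degrees stay below `n t`, and
  -- the later factor `d i` accounts for the `+ 1`.
  let κ : Fin n →₀ ℕ := Finsupp.equivFunOnFinite.symm fun j => if j ≤ i then t else 0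
  have hκ : ∀ j, κ j = if j ≤ i then t else 0 := fun j => rfl
  have hcard : Module.finrank K (box Δ κ) = (t + 1) ^ (i.val + 1) := by
    rw [finrank_box]
    have : ∀ j, κ j + 1 = if j ∈ Finset.Iic i then t + 1 else 1 := by
      intro j
      rw [hκ]
      simp only [Finset.mem_Iic]
      split_ifs <;> rfl
    simp only [this]
    rw [Finset.prod_ite_mem, Finset.univ_inter, Finset.prod_const, Fin.card_Iic]
  have hdeg : ∀ μ ≤ κ, μ.degree ≤ n * t := by
    intro μ hμ
    rw [Finsupp.degree_eq_sum]
    refine (Finset.sum_le_card_nsmul _ _ t fun j _ => (hμ j).trans ?_).trans (by simp)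
    rw [hκ]
    split_ifs <;> omega
  -- Right multiplication by `d i` shifts monomials without differentiating coefficients; on `box Δ
  -- κ` it makes `i` the last place of each monomial.
  let g : DiffOp Δ →ₗ[K] (Fin m → DiffOp Δ) :=
    { toFun := fun P => Pi.single k (P * d Δ i)
      map_add' := fun P Q => by rw [add_mul, Pi.single_add]
      map_smul' := fun a P => by
        rw [smul_mul_assoc, RingHom.id_apply, ← Pi.single_smul] }
  let I := R.equations Δ fun _ => True
  have hg : ∀ P ∈ box Δ κ, g P ∈ Submodule.pi Set.univ fun _ : Fin m => ofOrder Δ (n * t + 1) := by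
    intro P hP k' _
    change (Pi.single k (P * d Δ i) : Fin m → DiffOp Δ) k' ∈ _
    by_cases hkk : k' = k
    · subst hkk
      rw [Pi.single_eq_same]
      refine (Finsupp.mem_supported K _).mpr fun ν hν => ?_
      have h1 : coeff ν (P * mono (Finsupp.single i 1) 1) ≠ 0 := Finsupp.mem_support_iff.mp hν
      rw [coeff_mul_mono_one] at h1
      split_ifs at h1 with hle
      · have h2 := hdeg _ (mem_box.mp hP _ h1)
        have h3 : ν.degree = (ν - Finsupp.single i 1).degree + 1 := by
          conv_lhs => rw [← tsub_add_cancel_of_le hle, map_add, Finsupp.degree_single]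
        rw [Set.mem_ofPred_eq, h3]
        omega
      · exact absurd rfl h1
    · rw [Pi.single_eq_of_ne hkk]
      exact zero_mem _
  let f : box Δ κ →ₗ[K] filtration I (n * t + 1) :=
    ((I.mkQ.restrictScalars K) ∘ₗ g ∘ₗ (box Δ κ).subtype).codRestrict _ fun P =>
      Submodule.mem_map_of_mem (hg P.1 P.2)
  rw [← hcard]
  refine LinearMap.finrank_le_finrank_of_injective (f := f) ?_
  rw [← LinearMap.ker_eq_bot, LinearMap.ker_eq_bot']
  rintro ⟨P, hP⟩ hP0
  have hmem : g P ∈ I := (Submodule.Quotient.mk_eq_zero _).mp (congrArg Subtype.val hP0)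
  by_contra hne
  have hPne : P ≠ 0 := fun h => hne (Subtype.ext h)
  obtain ⟨μ, hμ, hmax⟩ := Finset.exists_max_image (Finsupp.support P) toColex
    (Finsupp.support_nonempty_iff.mpr hPne)
  have hμ' : coeff μ P ≠ 0 := Finsupp.mem_support_iff.mp hμ
  have hv : ∀ ν, vcoeff ν (g P) = Pi.single k (coeff ν (P * mono (Finsupp.single i 1) 1)) :=
    fun ν => vcoeff_single ν k _
  -- An element `g P` of the system would have as leading vector a nonzero multiple of the basis
  -- vector `k`, which was chosen outside the row span.
  have h1 := hR.vcoeff_mem_span hmem (i := i) (μ := μ) (fun j hj => by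
    have := mem_box.mp hP μ hμ' j
    rw [hκ, if_neg (not_le.mpr hj)] at this
    omega) (by
    intro ν hν
    rw [hv, coeff_mul_mono_one]
    split_ifs with hle
    · by_cases h0 : coeff (ν - Finsupp.single i 1) P = 0
      · rw [h0, Pi.single_zero]
      · have h2 := hmax _ (Finsupp.mem_support_iff.mpr h0)
        have h3 := add_le_add_left h2 (toColex (Finsupp.single i 1))
        rw [← toColex_add, ← toColex_add, tsub_add_cancel_of_le hle] at h3
        exact absurd hν (not_lt.mpr h3)
    · exact Pi.single_zero _)
  rw [hv, coeff_mul_mono_one, if_pos le_add_self, add_tsub_cancel_right] at h1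
  have h4 := Submodule.smul_mem _ (coeff μ P)⁻¹ h1
  rw [← Pi.single_smul, smul_eq_mul, inv_mul_cancel₀ hμ'] at h4
  exact hk h4

/-- If `cd(M) = r`, all the jets of class greater than `n - r` are principal. -/
theorem IsInvolutive.span_eq_top (hR : R.IsInvolutive Δ) {r : ℕ}
    (hr : HasCodim (R.equations Δ fun _ => True) r) {i : Fin n} (hi : n - r ≤ i.val) :
    Submodule.span K (Set.range fun τ : {τ : Fin p // R.cls τ = i} => R.a τ i) = ⊤ := by
  by_contra h
  obtain ⟨f, -, hdeg, hev⟩ := hr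
  have ht : Filter.Tendsto (fun t : ℕ => n * t + 1) Filter.atTop Filter.atTop := by
    refine Filter.tendsto_atTop_mono (fun t => ?_) Filter.tendsto_id
    have : 0 < n := i.pos
    simp only [id]
    nlinarith
  have := natDegree_gt_of_le_eval f i.val n (by
    filter_upwards [ht.eventually hev] with t h1
    rw [← h1]
    exact_mod_cast hR.pow_le_finrank_filtration h t)
  omega

/-- A principal jet is congruent to a combination of smaller jets modulo the system. -/
lemma exists_reduction {i : Fin n} {k : Fin m} (hk : (Pi.single k 1 : Fin m → K) ∈
      Submodule.span K (Set.range fun τ : {τ : Fin p // R.cls τ = i} => R.a τ i))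
    (μ : Fin n →₀ ℕ) :
    ∃ w ∈ R.equations Δ (fun _ => True), ∀ κ, toColex (μ + Finsupp.single i 1) ≤ toColex κ →
      vcoeff κ ((Pi.single k (mono (μ + Finsupp.single i 1) 1) : Fin m → DiffOp Δ) - w) = 0 := by
  obtain ⟨b, hb⟩ := (Submodule.mem_span_range_iff_exists_fun K).mp hk
  have hlead : ∀ τ : {τ : Fin p // R.cls τ = i},
      R.lead (τ.val, μ) = μ + Finsupp.single i 1 := by
    intro τ
    rw [lead, τ.2]
  -- The combination of rows that yields the basis vector, applied to the prolongations by `μ`, has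
  -- the given jet as leading term.
  refine ⟨∑ τ : {τ : Fin p // R.cls τ = i}, b τ • R.prolong Δ (τ.val, μ),
    Submodule.sum_mem _ fun τ _ => ?_, fun κ hκ => ?_⟩
  · rw [← C_smul]
    exact Submodule.smul_mem _ _ (prolong_mem_equations _ trivial)
  rw [map_sub, map_sum, vcoeff_single, coeff_mono]
  simp only [map_smul]
  split_ifs with e
  · rw [← hb, sub_eq_zero]
    refine Finset.sum_congr rfl fun τ _ => ?_
    rw [← e, ← hlead τ, vcoeff_lead_prolong, τ.2]
  · rw [Pi.single_zero, zero_sub, neg_eq_zero]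
    refine Finset.sum_eq_zero fun τ _ => ?_
    rw [leadLE_prolong (τ.val, μ) κ, smul_zero]
    rw [hlead τ]
    exact lt_of_le_of_ne hκ fun h => e (toColex.injective h)

/-- If all the jets of class greater than `s` are principal, then every element of `Dᵐ` is
congruent to an element of `K[d₁, …, dₛ]ᵐ` modulo the system. -/
theorem exists_inclFirst_sub_mem {s : ℕ}
    (h : ∀ i : Fin n, s ≤ i.val →
      Submodule.span K (Set.range fun τ : {τ : Fin p // R.cls τ = i} => R.a τ i) = ⊤)
    (v : Fin m → DiffOp Δ) :
    ∃ u, v - inclFirst Δ s m u ∈ R.equations Δ fun _ => True := by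
  classical
  let F : Submodule K (DiffOp Δ) :=
    Finsupp.supported K K {μ : Fin n →₀ ℕ | ∀ j : Fin n, s ≤ j.val → μ j = 0}
  have hF : ∀ P ∈ F, P ∈ firstVars Δ s := fun P hP μ hμ =>
    (Finsupp.mem_supported K P).mp hP (Finsupp.mem_support_iff.mpr hμ)
  let N : Submodule K (Fin m → DiffOp Δ) := Submodule.pi Set.univ (fun _ => F) ⊔
    (R.equations Δ fun _ => True).restrictScalars K
  have hsum : ∀ v : Fin m → DiffOp Δ, (∀ κ k, coeff κ (v k) ≠ 0 →
      (Pi.single k (mono κ 1) : Fin m → DiffOp Δ) ∈ N) → v ∈ N := by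
    intro v hv
    rw [← Finset.univ_sum_single v]
    refine N.sum_mem fun k _ => ?_
    have : (Pi.single k (v k) : Fin m → DiffOp Δ) = ∑ κ ∈ Finsupp.support (v k),
        coeff κ (v k) • (Pi.single k (mono κ 1) : Fin m → DiffOp Δ) := by
      conv_lhs => rw [← sum_mono (v k)]
      simp only [← Pi.single_smul, ← mono_eq_smul]
      exact map_sum (AddMonoidHom.single (fun _ : Fin m => DiffOp Δ) k) _ _
    rw [this]
    exact N.sum_mem fun κ hκ => N.smul_mem _ (hv κ k (Finsupp.mem_support_iff.mp hκ))
  have hbasis : ∀ ρ : Colex (Fin n →₀ ℕ), ∀ k : Fin m,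
      (Pi.single k (mono (ofColex ρ) 1) : Fin m → DiffOp Δ) ∈ N := by
    intro ρ
    -- A monomial outside `K[d₁, …, dₛ]` has its last place beyond the first `s`, so it is principal
    -- and reduces to smaller monomials; the colexicographic order is a well-order.
    induction ρ using WellFoundedLT.induction with
    | _ ρ ih =>
    intro k
    by_cases hρ : ∀ j : Fin n, s ≤ j.val → ofColex ρ j = 0
    · refine Submodule.mem_sup_left fun k' _ => ?_
      by_cases hkk : k' = k
      · subst hkk
        rw [Pi.single_eq_same]
        exact Finsupp.single_mem_supported K 1 hρ
      · rw [Pi.single_eq_of_ne hkk]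
        exact zero_mem _
    · have hne : ofColex ρ ≠ 0 := fun h0 => hρ fun j _ => by rw [h0]; rfl
      obtain ⟨i, μ, hμρ, hμ⟩ := exists_eq_add_single hne
      have hi : s ≤ i.val := by
        by_contra hlt
        refine hρ fun j hj => ?_
        rw [hμρ]
        have hij : i < j := Fin.lt_def.mpr (by omega)
        rw [Finsupp.add_apply, hμ j hij, Finsupp.single_eq_of_ne hij.ne', zero_add]
      have hk : (Pi.single k 1 : Fin m → K) ∈
          Submodule.span K (Set.range fun τ : {τ : Fin p // R.cls τ = i} => R.a τ i) := by
        rw [h i hi]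
        trivial
      obtain ⟨w, hw, hwρ⟩ := exists_reduction (Δ := Δ) hk μ
      rw [← hμρ] at hwρ
      rw [← sub_add_cancel (Pi.single k (mono (ofColex ρ) 1)) w]
      refine N.add_mem (hsum _ fun κ k' hκ => ?_) (Submodule.mem_sup_right hw)
      refine ih (toColex κ) ?_ k'
      by_contra hlt
      exact hκ (congrFun (hwρ κ (not_lt.mp hlt)) k')
  obtain ⟨x, hx, y, hy, hxy⟩ := Submodule.mem_sup.mp (hsum v fun κ k _ => hbasis (toColex κ) k)
  refine ⟨fun k => ⟨x k, hF _ (hx k trivial)⟩, ?_⟩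
  rw [← hxy]
  have : x + y - inclFirst Δ s m (fun k => ⟨x k, hF _ (hx k trivial)⟩) = y := by
    change x + y - x = y
    abel
  rw [this]
  exact hy

end

end FirstOrderSystem

/-! ### Presentations of localized modules -/

namespace OreLocalization

open nonZeroDivisors

variable {A : Type*} [Ring A] [OreSet A⁰] {m : ℕ}

/-- The canonical map of `Aᵐ` to its localization. -/
noncomputable def numeratorVec (u : Fin m → A) : Fin m → OreLocalization A⁰ A :=
  fun k => numeratorHom (u k)

lemma numeratorVec_smul (P : A) (u : Fin m → A) :
    numeratorVec (P • u) = (numeratorHom P : OreLocalization A⁰ A) • numeratorVec u :=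
  funext fun k => map_mul numeratorHom P (u k)

lemma numeratorVec_single (k : Fin m) :
    numeratorVec (Pi.single k (1 : A)) = Pi.single k 1 :=
  funext fun k' => Pi.apply_single (fun _ => (numeratorHom : A → OreLocalization A⁰ A))
    (fun _ => numeratorHom_zero) k _ k' |>.trans (by rw [map_one])

lemma numeratorVec_sum {N : ℕ} (u : Fin N → Fin m → A) :
    numeratorVec (∑ i, u i) = ∑ i, numeratorVec (u i) := by
  ext k
  simp only [numeratorVec, Finset.sum_apply, numeratorHom_sum]

/-- Localization of generators of a submodule. -/
lemma numeratorVec_mem_span {T : Set (Fin m → A)} {u : Fin m → A} (hu : u ∈ Submodule.span A T)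
    {W : Submodule (OreLocalization A⁰ A) (Fin m → OreLocalization A⁰ A)}
    (hT : ∀ v ∈ T, numeratorVec v ∈ W) : numeratorVec u ∈ W := by
  obtain ⟨N, f, g, rfl⟩ := Submodule.mem_span_set'.mp hu
  rw [numeratorVec_sum]
  refine W.sum_mem fun i _ => ?_
  rw [numeratorVec_smul]
  exact W.smul_mem _ (hT _ (g i).2)

lemma numeratorHom_ne_zero {P : A} (hP : P ≠ 0) :
    (numeratorHom P : OreLocalization A⁰ A) ≠ 0 := fun h =>
  hP (numeratorHom_injective (h.trans numeratorHom_zero.symm))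

variable [Nontrivial A] [NoZeroDivisors A]

lemma mem_of_numeratorHom_smul_mem {Y : Type*} [AddCommGroup Y] [Module (OreLocalization A⁰ A) Y]
    {W : Submodule (OreLocalization A⁰ A) Y} {P : A} (hP : P ≠ 0) {y : Y}
    (h : (numeratorHom P : OreLocalization A⁰ A) • y ∈ W) : y ∈ W :=
  (W.smul_mem_iff (numeratorHom_ne_zero hP)).mp h

/-- The localization of a finitely generated module is presented by the localized relations. -/
theorem exists_quotient_equiv {X : Type*} [AddCommGroup X] [Module A X] (π : (Fin m → A) →ₗ[A] X)
    (hπ : Function.Surjective π)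
    (W : Submodule (OreLocalization A⁰ A) (Fin m → OreLocalization A⁰ A))
    (hker : ∀ u ∈ LinearMap.ker π, numeratorVec u ∈ W)
    (hW : W ≤ Submodule.span _ (numeratorVec '' (LinearMap.ker π : Set (Fin m → A)))) :
    ∃ e : ((Fin m → OreLocalization A⁰ A) ⧸ W) ≃ₗ[OreLocalization A⁰ A] OreLocalization A⁰ X,
      ∀ k, e (Submodule.Quotient.mk (Pi.single k 1)) = π (Pi.single k 1) /ₒ (1 : A⁰) := by
  let f : (Fin m → OreLocalization A⁰ A) →ₗ[OreLocalization A⁰ A] OreLocalization A⁰ X :=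
    Fintype.linearCombination _ fun k => π (Pi.single k 1) /ₒ (1 : A⁰)
  have hf : ∀ u, f (numeratorVec u) = π u /ₒ (1 : A⁰) := by
    intro u
    rw [Fintype.linearCombination_apply]
    have h1 : π u = ∑ k, u k • π (Pi.single k 1) := by
      conv_lhs => rw [pi_eq_sum_univ' u]
      rw [map_sum]
      simp only [map_smul]
    rw [h1]
    have h2 := map_sum (AddMonoidHom.mk' (fun x : X => x /ₒ (1 : A⁰)) oreDiv_one_add)
      (fun k => u k • π (Pi.single k 1)) Finset.univ
    refine (Eq.trans h2 (Finset.sum_congr rfl fun k _ => ?_)).symm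
    exact smul_oreDiv_one_eq _ _
  have hsurj : Function.Surjective f := by
    intro y
    induction y using OreLocalization.ind with
    | _ x s =>
    obtain ⟨u, rfl⟩ := hπ x
    refine ⟨((1 : A) /ₒ s : OreLocalization A⁰ A) • numeratorVec u, ?_⟩
    rw [map_smul, hf, ← oreDiv_eq_smul]
  have hkerf : LinearMap.ker f = W := by
    apply le_antisymm
    · intro v hv
      -- Write `v = s⁻¹ u`. Vanishing of `π u` in the localization means `t • π u = 0` for some `t`,
      -- so `t • u` is a relation, and `t` and `s` can be cancelled in `W`.
      obtain ⟨s, u, hu⟩ := exists_common_denom v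
      have hvu : (numeratorHom (s : A) : OreLocalization A⁰ A) • v = numeratorVec u := by
        ext k
        rw [Pi.smul_apply, smul_eq_mul, hu, numeratorHom_apply, OreLocalization.mul_cancel]
        rfl
      have h1 : π u /ₒ (1 : A⁰) = 0 := by
        rw [← hf, ← hvu, map_smul, LinearMap.mem_ker.mp hv, smul_zero]
      obtain ⟨t, ht⟩ := oreDiv_one_eq_zero_iff.mp h1
      have h2 : numeratorVec ((t : A) • u) ∈ W := hker _ (by rw [LinearMap.mem_ker, map_smul, ht])
      rw [numeratorVec_smul, ← hvu] at h2
      exact mem_of_numeratorHom_smul_mem (nonZeroDivisors.ne_zero s.2)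
        (mem_of_numeratorHom_smul_mem (nonZeroDivisors.ne_zero t.2) h2)
    · refine hW.trans (Submodule.span_le.mpr ?_)
      rintro _ ⟨u, hu, rfl⟩
      change f _ = 0
      rw [hf, LinearMap.mem_ker.mp hu, zero_oreDiv]
  refine ⟨(Submodule.quotEquivOfEq _ _ hkerf.symm).trans (f.quotKerEquivOfSurjective hsurj),
    fun k => ?_⟩
  change f (Pi.single k 1) = _
  rw [← numeratorVec_single, hf]

end OreLocalization

/-! ### Localization of the system -/

namespace FirstOrderSystem

noncomputable section

open DiffOp OreLocalization

variable {n m p : ℕ} {K : Type*} [Field K] {R : FirstOrderSystem K n m p}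
  {Δ : CommDerivations n K}

lemma numeratorVec_eqnFirst {s : ℕ} (τ : Fin p) (h : R.classNum τ ≤ s) :
    numeratorVec (R.eqnFirst Δ τ h) = R.locEqn Δ τ h := rfl

/-- After localization the equations of class less than `s` depend linearly on those of strict
class `s`. -/
theorem IsInvolutive.locEqn_mem (hR : R.IsInvolutive Δ) {s : ℕ} (hs : s ≤ n) {τ : Fin p}
    (h : R.classNum τ ≤ s) : R.locEqn Δ τ h ∈ R.strictEquations Δ s := by
  have hpos : 0 < s := by unfold classNum at h; omega
  obtain ⟨P, hP, hmem⟩ := hR.exists_smul_mem (i₀ := ⟨s - 1, by omega⟩)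
    (Nat.sub_add_cancel hpos) h
  refine mem_of_numeratorHom_smul_mem hP ?_
  rw [← numeratorVec_eqnFirst, ← numeratorVec_smul]
  refine numeratorVec_mem_span hmem ?_
  rintro _ ⟨σ, hσ, rfl⟩
  exact Submodule.subset_span ⟨σ, hσ, rfl⟩

lemma toLoc_add {X : Type*} {s : ℕ} [AddCommGroup X] [Module (firstVars Δ s) X] (x y : X) :
    toLoc Δ s (x + y) = toLoc Δ s x + toLoc Δ s y := oreDiv_one_add x y

lemma toLoc_smul {X : Type*} {s : ℕ} [AddCommGroup X] [Module (firstVars Δ s) X]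
    (P : firstVars Δ s) (x : X) :
    toLoc Δ s (P • x) = (numeratorHom P : FracFirst Δ s) • toLoc Δ s x := smul_oreDiv_one_eq P x

/-- The localization of the whole system is generated by the equations of class at least `s`. -/
theorem IsInvolutive.span_toLoc_equations (hR : R.IsInvolutive Δ) {s : ℕ} (hs : s ≤ n) :
    Submodule.span (FracFirst Δ s)
        (toLoc Δ s '' (R.equations Δ fun _ => True : Set (Fin m → DiffOp Δ))) =
      Submodule.span (FracFirst Δ s)
        (toLoc Δ s '' (R.equations Δ fun c => s ≤ c : Set (Fin m → DiffOp Δ))) := by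
  classical
  apply le_antisymm
  · refine Submodule.span_le.mpr ?_
    rintro _ ⟨v, hv, rfl⟩
    set W := Submodule.span (FracFirst Δ s)
      (toLoc Δ s '' (R.equations Δ fun c => s ≤ c : Set (Fin m → DiffOp Δ)))
    have hlow : ∀ τ, R.classNum τ ≤ s → toLoc Δ s (R.eqn Δ τ) ∈ W := by
      intro τ h
      have hpos : 0 < s := by unfold classNum at h; omega
      obtain ⟨P, hP, hmem⟩ := hR.exists_smul_mem (i₀ := ⟨s - 1, by omega⟩)
        (Nat.sub_add_cancel hpos) h
      refine mem_of_numeratorHom_smul_mem hP ?_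
      rw [← toLoc_smul]
      refine Submodule.subset_span ⟨_, ?_, rfl⟩
      have h1 := inclFirst_mem_equations (R := R) (Δ := Δ) (q := fun i => i = s)
        (fun _ h => h.le) hmem
      rw [map_smul] at h1
      refine Submodule.span_mono ?_ h1
      rintro _ ⟨σ, hσ, rfl⟩
      exact ⟨σ, hσ.ge, rfl⟩
    -- `toLoc` is only linear over `K[d₁, …, dₛ]`. In the multiplicative form, equations of class
    -- below `s` are multiplied by such operators alone.
    obtain ⟨c, hc, rfl⟩ := hR.exists_linearCombination hv
    rw [Finsupp.linearCombination_apply, Finsupp.sum]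
    change AddMonoidHom.mk' (toLoc Δ s) toLoc_add (∑ x ∈ c.support, c x • R.prolong Δ x) ∈ W
    rw [map_sum]
    refine W.sum_mem fun x hx => ?_
    change toLoc Δ s _ ∈ W
    by_cases hx' : s ≤ R.classNum x.1
    · refine Submodule.subset_span ⟨_, ?_, rfl⟩
      rw [← C_smul]
      exact Submodule.smul_mem _ _ (prolong_mem_equations x (c := fun i => s ≤ i) hx')
    · have hle : R.classNum x.1 ≤ s := (not_le.mp hx').le
      have hfirst : ∀ j : Fin n, s ≤ j.val → x.2 j = 0 := fun j hj => hc x hx j (by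
        unfold classNum at hle
        rw [Fin.lt_def]
        omega)
      have h1 : c x • R.prolong Δ x =
          (⟨mono x.2 (c x), mono_mem_firstVars hfirst _⟩ : firstVars Δ s) • R.eqn Δ x.1 :=
        smul_prolong_eq_inclFirst hle hfirst (c x)
      rw [h1, toLoc_smul]
      exact W.smul_mem _ (hlow _ hle)
  · refine Submodule.span_mono (Set.image_mono ?_)
    refine Submodule.span_mono ?_
    rintro _ ⟨σ, -, rfl⟩
    exact ⟨σ, trivial, rfl⟩

/-- The localization of a module with the generators `ȳ¹, …, ȳᵐ` and with the equations of class
at most `s` as relations over `K[d₁, …, dₛ]` is defined by the equations of strict class `s`. -/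
theorem IsInvolutive.exists_quotient_equiv (hR : R.IsInvolutive Δ) {s : ℕ} (hs : s ≤ n)
    {X : Type*} [AddCommGroup X] [Module (firstVars Δ s) X]
    (π : (Fin m → firstVars Δ s) →ₗ[firstVars Δ s] X) (hπ : Function.Surjective π)
    (hker : LinearMap.ker π = Submodule.span (firstVars Δ s)
      {Ψ : Fin m → firstVars Δ s | ∃ τ, ∃ h : R.classNum τ ≤ s, Ψ = R.eqnFirst Δ τ h}) :
    ∃ e : ((Fin m → FracFirst Δ s) ⧸ R.strictEquations Δ s) ≃ₗ[FracFirst Δ s] RelLoc Δ s X,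
      ∀ k, e (Submodule.Quotient.mk (Pi.single k 1)) = toLoc Δ s (π (Pi.single k 1)) := by
  refine OreLocalization.exists_quotient_equiv π hπ _ (fun u hu => ?_) (Submodule.span_mono ?_)
  · rw [hker] at hu
    refine numeratorVec_mem_span hu ?_
    rintro _ ⟨τ, h, rfl⟩
    exact hR.locEqn_mem hs h
  · rintro _ ⟨τ, h, rfl⟩
    refine ⟨R.eqnFirst Δ τ h.le, ?_, rfl⟩
    rw [hker]
    exact Submodule.subset_span ⟨τ, h.le, rfl⟩

end

end FirstOrderSystem

theorem proposition5p7 {K : Type*} [Field K] {n m p : ℕ} (Δ : CommDerivations n K)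
    (R : FirstOrderSystem K n m p) (hR : R.IsInvolutive Δ)
    (r : ℕ) (hr : DiffOp.HasCodim (R.equations Δ fun _ => True) r) :
    -- the equations of class `1` up to `n - r - 1` become consequences of those of class `n - r`
    (∀ (τ : Fin p) (h : R.classNum τ < n - r),
      R.locEqn Δ τ h.le ∈ R.strictEquations Δ (n - r)) ∧
    -- they are redundant in the localization of the whole system
    (Submodule.span (DiffOp.FracFirst Δ (n - r))
        (DiffOp.toLoc Δ (n - r) '' (R.equations Δ fun _ => True : Set (Fin m → DiffOp Δ))) =
      Submodule.span (DiffOp.FracFirst Δ (n - r))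
        (DiffOp.toLoc Δ (n - r) '' (R.equations Δ fun c => n - r ≤ c : Set (Fin m → DiffOp Δ)))) ∧
    -- the localization of the module of the equations of class at most `n - r`
    (∃ e : ((Fin m → DiffOp.FracFirst Δ (n - r)) ⧸ R.strictEquations Δ (n - r))
          ≃ₗ[DiffOp.FracFirst Δ (n - r)] DiffOp.RelLoc Δ (n - r) (R.moduleUpTo Δ (n - r)),
      ∀ k, e (Submodule.Quotient.mk (Pi.single k 1)) =
        DiffOp.toLoc Δ (n - r) (Submodule.Quotient.mk (Pi.single k 1))) ∧
    -- the localization of the whole module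
    (∃ e : ((Fin m → DiffOp.FracFirst Δ (n - r)) ⧸ R.strictEquations Δ (n - r))
          ≃ₗ[DiffOp.FracFirst Δ (n - r)] DiffOp.RelLoc Δ (n - r) (R.diffModule Δ),
      ∀ k, e (Submodule.Quotient.mk (Pi.single k 1)) =
        DiffOp.toLoc Δ (n - r) (Submodule.Quotient.mk (Pi.single k 1))) := by
  have hs : n - r ≤ n := Nat.sub_le n r
  refine ⟨fun τ h => hR.locEqn_mem hs h.le, hR.span_toLoc_equations hs, ?_, ?_⟩
  · exact hR.exists_quotient_equiv hs (Submodule.mkQ _) (Submodule.mkQ_surjective _)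
      (Submodule.ker_mkQ _)
  · let I := R.equations Δ fun _ => True
    let π : (Fin m → DiffOp.firstVars Δ (n - r)) →ₗ[DiffOp.firstVars Δ (n - r)] R.diffModule Δ :=
      (I.mkQ.restrictScalars (DiffOp.firstVars Δ (n - r))).comp
        (FirstOrderSystem.inclFirst Δ (n - r) m)
    -- This is where the codimension enters: all jets of class above `n - r` are principal.
    have hπ : Function.Surjective π := by
      intro y
      obtain ⟨v, rfl⟩ := I.mkQ_surjective y
      obtain ⟨u, hu⟩ := FirstOrderSystem.exists_inclFirst_sub_mem
        (fun i hi => hR.span_eq_top hr (i := i) hi) v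
      exact ⟨u, ((Submodule.Quotient.eq I).mpr hu).symm⟩
    -- By elimination, `D'^m` meets the whole system exactly in the relations that define `M_r`.
    have hker : LinearMap.ker π = Submodule.span (DiffOp.firstVars Δ (n - r))
        {Ψ | ∃ τ, ∃ h : R.classNum τ ≤ n - r, Ψ = R.eqnFirst Δ τ h} := by
      ext u
      exact (Submodule.Quotient.mk_eq_zero I).trans hR.mem_span_eqnFirst
    obtain ⟨e, he⟩ := hR.exists_quotient_equiv hs π hπ hker
    have hsingle : ∀ k, FirstOrderSystem.inclFirst Δ (n - r) m (Pi.single k 1) =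
        Pi.single k 1 := fun k => funext fun k' =>
      Pi.apply_single (fun _ (P : DiffOp.firstVars Δ (n - r)) => (P : DiffOp Δ))
        (fun _ => rfl) k 1 k'
    exact ⟨e, fun k => (he k).trans
      (congrArg (fun v => DiffOp.toLoc Δ (n - r) (I.mkQ v)) (hsingle k))⟩
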